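/- Let $\mathbf X=(X_1,\dots,X_n)$ be a random vector on a probability space $(\Omega,\mathcal F,\mathbb P)$, $S=\sum_{i=1}^n X_i$, let $F_i$ and $G$ be the distribution functions of $X_i$ and $S$, and write $H^{-1}(p)=\inf\{x\in\mathbb R: H(x)\ge p\}$ for a distribution function $H$. For $\beta\in(0,1)$ and a random variable $Y$ let $\mathrm{VaR}_\beta(Y)=\inf\{x\in\mathbb R:\mathbb P(Y\le x)\ge 1-\beta\}$ and, if $Y$ is integrable, $\mathrm{ES}_\beta(Y)=\frac1\beta\int_0^\beta \mathrm{VaR}_\gamma(Y)\,d\gamma$. For $\alpha\in(0,1)$ the diversification quotient is $\mathrm{DQ}^{\mathrm{ES}}_\alpha(\mathbf X)=\alpha^*/\alpha$, where $$\alpha^*=\inf\Big\{\beta\in(0,1):\ \mathrm{ES}_\beta(S)\le\sum_{i=1}^n\mathrm{ES}_\alpha(X_i)\Big\},\qquad \inf\varnothing=1 .$$ It depends only on the law of $\mathbf X$. Given i.i.d. random vectors $\mathbf X^{(1)},\mathbf X^{(2)},\dots$ with the law of $\mathbf X$, the empirical estimator $\widehat{\mathrm{DQ}^{\mathrm{ES}}_\alpha}(N)$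 is the diversification quotient of the empirical distribution of $\mathbf X^{(1)},\dots,\mathbf X^{(N)}$. **Theorem.** Fix $\alpha\in(0,1)$, put $t_i=F_i^{-1}(1-\alpha)$ and $s=G^{-1}(1-\alpha^*)$, and assume: 1. $\sum_{i=1}^n\mathrm{ES}_\alpha(X_i)<\mathrm{ess\,sup}(S)\in(-\infty,\infty]$; 2. for each $i$, the distribution of $X_i$ has on $[t_i,\infty)$ a density $f_i$ that is positive there, and $\mathbb E|X_i|^{2+\epsilon_i}<\infty$ for some $\epsilon_i>0$; 3. the distribution of $S$ has a density $g$ that is positive on $[s,\infty)$ and continuous at $s$, and $\mathbb E|S|^{2+\epsilon}<\infty$ for some $\epsilon>0$. Let $\mathbf A=(1/\alpha,\dots,1/\alpha,-1/\alpha^*)^\top\in\mathbb R^{n+1}$, let $\Sigma$ be the covariance matrix of $\big((X_1-t_1)_+,\dots,(X_n-t_n)_+,(S-s)_+\big)$, and let $$c=\frac{\mathrm{VaR}_{\alpha^*}(S)-\mathrm{ES}_{\alpha^*}(S)}{\mathrm{DQ}^{\mathrm{ES}}_\alpha(\mathbf X)} .$$ Then $\mathrm{DQ}^{\mathrm{ES}}_\alpha(\mathbf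 X)>0$, $c\neq 0$, $\mathbf A^\top\Sigma\mathbf A/c^2\ge 0$, and as $N\to\infty$ $$\sqrt N\Big(\widehat{\mathrm{DQ}^{\mathrm{ES}}_\alpha}(N)-\mathrm{DQ}^{\mathrm{ES}}_\alpha(\mathbf X)\Big)\ \xrightarrow{\ d\ }\ \mathrm N\Big(0,\ \frac{\mathbf A^\top\Sigma\mathbf A}{c^2}\Big),$$ where $\mathrm N(0,0)$ is the point mass at $0$. -/

import Mathlib

open MeasureTheory ProbabilityTheory Filter
open scoped ENNReal

noncomputable section

namespace DQ

variable {Ω : Type*} [MeasurableSpace Ω]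

/-- The (left-continuous) quantile function of `X` at level `p`:
`F⁻¹(p) = inf {x : P(X ≤ x) ≥ p}`. -/
def quantile (P : Measure Ω) (X : Ω → ℝ) (p : ℝ) : ℝ :=
  sInf {x : ℝ | p ≤ P.real {ω | X ω ≤ x}}

/-- Value at Risk, in the small-`α` convention: `inf {x : P(X ≤ x) ≥ 1 - α}`. -/
def VaR (P : Measure Ω) (α : ℝ) (X : Ω → ℝ) : ℝ :=
  sInf {x : ℝ | 1 - α ≤ P.real {ω | X ω ≤ x}}

/-- Expected Shortfall at level `α ∈ (0, 1)`: the average of `VaR_β(X)` over `β ∈ (0, α)`. -/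
def ES (P : Measure Ω) (α : ℝ) (X : Ω → ℝ) : ℝ :=
  (1 / α) * ∫ β in (0 : ℝ)..α, VaR P β X

/-- The total loss `S = X₁ + ⋯ + Xₙ` of a portfolio. -/
def total {n : ℕ} (X : Ω → Fin n → ℝ) (ω : Ω) : ℝ := ∑ i, X ω i

/-- The levels `β ∈ (0, 1)` with `ES_β(S) ≤ ∑ i, ES_α(X_i)`. -/
def levelSet {n : ℕ} (P : Measure Ω) (α : ℝ) (X : Ω → Fin n → ℝ) : Set ℝ :=
  {β : ℝ | β ∈ Set.Ioo (0 : ℝ) 1 ∧ ES P β (total X) ≤ ∑ i, ES P α (fun ω => X ω i)}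

open Classical in
/-- `α*`, the infimum of the level set in `(0, 1)`, with the convention `inf ∅ = 1`. -/
def alphaStar {n : ℕ} (P : Measure Ω) (α : ℝ) (X : Ω → Fin n → ℝ) : ℝ :=
  if (levelSet P α X).Nonempty then sInf (levelSet P α X) else 1

/-- The diversification quotient `DQ^ES_α(X) = α* / α`. -/
def DQES {n : ℕ} (P : Measure Ω) (α : ℝ) (X : Ω → Fin n → ℝ) : ℝ :=
  alphaStar P α X / α

/-- The empirical distribution of the first `N` vectors of a sequence in `ℝⁿ`:
mass `1 / N` at each of them. -/
def empiricalMeasure {n : ℕ} (x : ℕ → Fin n → ℝ) (N : ℕ) : Measure (Fin n → ℝ) :=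
  (N : ℝ≥0∞)⁻¹ • ∑ k ∈ Finset.range N, Measure.dirac (x k)

/-- The empirical estimator: the diversification quotient of (the identity random vector under)
the empirical distribution of the first `N` samples. -/
def empiricalDQES {n : ℕ} (α : ℝ) (x : ℕ → Fin n → ℝ) (N : ℕ) : ℝ :=
  DQES (empiricalMeasure x N) α (fun y : Fin n → ℝ => y)

/-- On the set `A`, the distribution `ν` has the Lebesgue density `f`. -/
def HasDensityOn (ν : Measure ℝ) (f : ℝ → ℝ) (A : Set ℝ) : Prop :=
  Measurable f ∧ (∀ x ∈ A, 0 ≤ f x) ∧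
    ν.restrict A = (volume.restrict A).withDensity (fun x => ENNReal.ofReal (f x))

/-- Tail condition on the component `X_i`: with `t = F_i⁻¹(1 - α)`, it has a positive density on
`[t, ∞)`, and a finite absolute moment of some order larger than `2`. -/
def ComponentCondition (P : Measure Ω) (α : ℝ) (Y : Ω → ℝ) : Prop :=
  (∃ f : ℝ → ℝ, HasDensityOn (P.map Y) f (Set.Ici (quantile P Y (1 - α))) ∧
    ∀ x ∈ Set.Ici (quantile P Y (1 - α)), 0 < f x) ∧
  ∃ ε : ℝ, 0 < ε ∧ Integrable (fun ω => |Y ω| ^ (2 + ε)) P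

/-- Condition on the total loss, at level `a`: with `s = G⁻¹(1 - a)`, it has a density on `ℝ` that
is positive on `[s, ∞)` and continuous at `s`, and a finite absolute moment of some order larger
than `2`. -/
def TotalCondition (P : Measure Ω) (a : ℝ) (S : Ω → ℝ) : Prop :=
  (∃ g : ℝ → ℝ, HasDensityOn (P.map S) g Set.univ ∧
    (∀ x ∈ Set.Ici (quantile P S (1 - a)), 0 < g x) ∧
    ContinuousAt g (quantile P S (1 - a))) ∧
  ∃ ε : ℝ, 0 < ε ∧ Integrable (fun ω => |S ω| ^ (2 + ε)) P

/-- The vector `(1/α, …, 1/α, -1/α*)` in `ℝⁿ⁺¹`. -/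
def vecA {n : ℕ} (P : Measure Ω) (α : ℝ) (X : Ω → Fin n → ℝ) : Fin (n + 1) → ℝ :=
  Fin.snoc (α := fun _ => ℝ) (fun _ : Fin n => 1 / α) (-1 / alphaStar P α X)

/-- The random vector `((X₁ - t₁)₊, …, (Xₙ - tₙ)₊, (S - s)₊)` with `t_i = F_i⁻¹(1 - α)` and
`s = G⁻¹(1 - α*)`. -/
def excess {n : ℕ} (P : Measure Ω) (α : ℝ) (X : Ω → Fin n → ℝ) (ω : Ω) : Fin (n + 1) → ℝ :=
  Fin.snoc (α := fun _ => ℝ)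
    (fun i : Fin n => max (X ω i - quantile P (fun ω' => X ω' i) (1 - α)) 0)
    (max (total X ω - quantile P (total X) (1 - alphaStar P α X)) 0)

/-- The covariance matrix of the vector of excesses. -/
def covMat {n : ℕ} (P : Measure Ω) (α : ℝ) (X : Ω → Fin n → ℝ) :
    Matrix (Fin (n + 1)) (Fin (n + 1)) ℝ :=
  Matrix.of fun i j => covariance (fun ω => excess P α X ω i) (fun ω => excess P α X ω j) P

/-- `c = (VaR_{α*}(S) - ES_{α*}(S)) / DQ^ES_α(X)`. -/
def cES {n : ℕ} (P : Measure Ω) (α : ℝ) (X : Ω → Fin n → ℝ) : ℝ :=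
  (VaR P (alphaStar P α X) (total X) - ES P (alphaStar P α X) (total X)) / DQES P α X

/-- The asymptotic variance `Aᵀ Σ A / c²`. -/
def sigmaSq {n : ℕ} (P : Measure Ω) (α : ℝ) (X : Ω → Fin n → ℝ) : ℝ :=
  dotProduct (vecA P α X) (Matrix.mulVec (covMat P α X) (vecA P α X)) / cES P α X ^ 2

end DQ

end

/-! Everything rests on the Rockafellar–Uryasev formula: a·ES_a(Y) is the minimum over x of a·x +
E(Y − x)₊, attained at x = VaR_a(Y) (`mul_ES_le`, `mul_ES_eq_VaR`). Hence, with m = ∑ ES_α(X_i), the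
condition ES_b(S) ≤ m asks for some x with E(S − x)₊ ≤ b(m − x), and α* is the optimal value of the
ratio E(S − x)₊ / (m − x), attained at x = s.

An optimal value reacts to a small perturbation, to first order, only through the objective at the
unperturbed optimizer. So the quantiles t_i and s may be frozen when the law is replaced by the
empirical one. With u = m − s, the error of the empirical α* is then Z/u up to a negligible term,
where Z is the empirical mean of the centred function `influence`, and the central limit theorem
applies to Z.

The rigorous version never tracks the empirical quantiles. The population objective is strictly
larger at distance δ on both sides of its minimizer (`strict_minimizer`). The law of large numbers
passes these finitely many inequalities to the empirical objective, and convexity then bounds the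
cost of freezing by δ·|level − empirical tail probability| (`near_minimizer`). Multiplied by √N, the
remainder is at most a constant times δ times an `envelope` bounded in L¹ (`eventually_remainder`,
`fluctuation_bound`). As δ is arbitrary, it vanishes in probability, and Slutsky's lemma concludes.
`quadraticForm_covMat` identifies the variance. -/

namespace DQ

/-! ### Stop-loss transform. -/

section StopLoss

variable {Ω : Type*} [MeasurableSpace Ω] {P : Measure Ω} {Y : Ω → ℝ}

/-- The stop-loss transform `E (Y - x)₊`. -/
noncomputable def stopLoss (P : Measure Ω) (Y : Ω → ℝ) (x : ℝ) : ℝ := ∫ ω, max (Y ω - x) 0 ∂P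

lemma stopLoss_nonneg (x : ℝ) : 0 ≤ stopLoss P Y x :=
  integral_nonneg fun _ => le_max_right _ _

lemma mul_ES_eq {a : ℝ} (ha : 0 < a) : a * ES P a Y = ∫ β in Set.Ioo (0 : ℝ) a, VaR P β Y := by
  rw [ES, intervalIntegral.integral_of_le ha.le, integral_Ioc_eq_integral_Ioo]
  field_simp

end StopLoss

/-! ### Quantile transform and the Rockafellar–Uryasev formula. -/

section Quantile

variable {Ω : Type*} [MeasurableSpace Ω] {P : Measure Ω} [IsProbabilityMeasure P] {Y : Ω → ℝ}

lemma cdf_map_eq (hY : Measurable Y) (x : ℝ) : cdf (P.map Y) x = P.real {ω | Y ω ≤ x} := by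
  have := Measure.isProbabilityMeasure_map (μ := P) hY.aemeasurable
  rw [cdf_eq_real, measureReal_def, Measure.map_apply hY measurableSet_Iic, measureReal_def]
  rfl

/-- Right continuity of the distribution function makes the infimum attained; a level strictly
between 0 and 1 makes the set nonempty and bounded below, so that `sInf` is not a default value. -/
lemma VaR_le_iff (hY : Measurable Y) {β : ℝ} (h0 : 0 < β) (h1 : β < 1) (x : ℝ) :
    VaR P β Y ≤ x ↔ 1 - β ≤ P.real {ω | Y ω ≤ x} := by
  have := Measure.isProbabilityMeasure_map (μ := P) hY.aemeasurable
  simp only [VaR, ← cdf_map_eq hY]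
  set F := cdf (P.map Y)
  have hbdd : BddBelow {x : ℝ | 1 - β ≤ F x} := by
    obtain ⟨m, hm⟩ := ((tendsto_cdf_atBot (P.map Y)).eventually
      (gt_mem_nhds (sub_pos.2 h1))).exists
    refine ⟨m, fun y hy => ?_⟩
    by_contra! hlt
    have h : F y ≤ F m := monotone_cdf _ hlt.le
    exact absurd (lt_of_le_of_lt h hm) (not_lt.2 hy)
  have hne : {x : ℝ | 1 - β ≤ F x}.Nonempty := by
    obtain ⟨m, hm⟩ := ((tendsto_cdf_atTop (P.map Y)).eventually
      (lt_mem_nhds (show 1 - β < 1 by linarith))).exists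
    exact ⟨m, hm.le⟩
  refine ⟨fun h => ?_, fun h => csInf_le hbdd h⟩
  have hcont : Tendsto F (nhdsWithin x (Set.Ioi x)) (nhds (F x)) :=
    ((F.right_continuous x).mono Set.Ioi_subset_Ici_self)
  refine ge_of_tendsto hcont ?_
  filter_upwards [self_mem_nhdsWithin] with y hy
  obtain ⟨z, hz, hzy⟩ := (csInf_lt_iff hbdd hne).1 (lt_of_le_of_lt h hy)
  exact le_trans hz (monotone_cdf _ hzy.le)

lemma VaR_antitoneOn (hY : Measurable Y) :
    AntitoneOn (fun β => VaR P β Y) (Set.Ioo (0 : ℝ) 1) := by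
  intro b hb c hc hbc
  have := (VaR_le_iff (P := P) hY hb.1 hb.2 (VaR P b Y)).1 le_rfl
  exact (VaR_le_iff hY hc.1 hc.2 _).2 (by linarith)

lemma aemeasurable_VaR (hY : Measurable Y) :
    AEMeasurable (fun β => VaR P β Y) (volume.restrict (Set.Ioo (0 : ℝ) 1)) :=
  aemeasurable_restrict_of_antitoneOn measurableSet_Ioo (VaR_antitoneOn hY)

/-- The quantile transform: under the uniform distribution of the level, `VaR` has the law
of `Y`. -/
lemma map_VaR (hY : Measurable Y) :
    (volume.restrict (Set.Ioo (0 : ℝ) 1)).map (fun β => VaR P β Y) = P.map Y := by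
  have hP := Measure.isProbabilityMeasure_map (μ := P) hY.aemeasurable
  have : IsFiniteMeasure ((volume.restrict (Set.Ioo (0 : ℝ) 1)).map (fun β => VaR P β Y)) := by
    infer_instance
  refine Measure.ext_of_Iic _ _ fun x => ?_
  rw [Measure.map_apply_of_aemeasurable (aemeasurable_VaR hY) measurableSet_Iic,
    Measure.map_apply hY measurableSet_Iic]
  rw [Measure.restrict_apply₀' measurableSet_Ioo.nullMeasurableSet]
  have hset : (fun β => VaR P β Y) ⁻¹' Set.Iic x ∩ Set.Ioo (0 : ℝ) 1
      = Set.Ici (1 - P.real {ω | Y ω ≤ x}) ∩ Set.Ioo 0 1 := by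
    ext β
    simp only [Set.mem_inter_iff, Set.mem_preimage, Set.mem_Iic, Set.mem_Ici]
    refine and_congr_left fun hβ => ?_
    rw [VaR_le_iff hY hβ.1 hβ.2]
    constructor <;> intro h <;> linarith
  rw [hset]
  have h0 : 0 ≤ P.real {ω | Y ω ≤ x} := measureReal_nonneg
  have h1 : P.real {ω | Y ω ≤ x} ≤ 1 := measureReal_le_one
  have hr : P (Y ⁻¹' Set.Iic x) = ENNReal.ofReal (P.real {ω | Y ω ≤ x}) := by
    rw [measureReal_def, ENNReal.ofReal_toReal (measure_ne_top _ _)]; rfl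
  rw [hr]
  set F := P.real {ω | Y ω ≤ x}
  apply le_antisymm
  · refine (measure_mono (t := Set.Icc (1 - F) 1) fun β hβ => ⟨hβ.1, hβ.2.2.le⟩).trans ?_
    rw [Real.volume_Icc]; simp
  · refine le_trans ?_ (measure_mono (s := Set.Ioo (1 - F) 1) fun β hβ =>
      ⟨hβ.1.le, lt_of_le_of_lt (by linarith) hβ.1, hβ.2⟩)
    rw [Real.volume_Ioo]; simp

lemma integrableOn_VaR (hY : Measurable Y) (hi : Integrable Y P) :
    IntegrableOn (fun β => VaR P β Y) (Set.Ioo (0 : ℝ) 1) := by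
  have h : Integrable (fun y : ℝ => y) (P.map Y) :=
    (integrable_map_measure (by fun_prop) hY.aemeasurable).2 hi
  rw [← map_VaR hY] at h
  exact (integrable_map_measure (by fun_prop) (aemeasurable_VaR hY)).1 h

lemma integrable_excess (hi : Integrable Y P) (x : ℝ) :
    Integrable (fun ω => max (Y ω - x) 0) P :=
  (hi.sub (integrable_const x)).pos_part

lemma setIntegral_VaR_excess (hY : Measurable Y) (x : ℝ) :
    ∫ β in Set.Ioo (0 : ℝ) 1, max (VaR P β Y - x) 0 = stopLoss P Y x := by
  rw [stopLoss, ← integral_map (φ := Y) (f := fun y => max (y - x) 0) hY.aemeasurable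
    (by fun_prop), ← map_VaR hY, integral_map (aemeasurable_VaR hY) (by fun_prop)]

lemma integrableOn_VaR_excess (hY : Measurable Y) (hi : Integrable Y P) (x : ℝ) :
    IntegrableOn (fun β => max (VaR P β Y - x) 0) (Set.Ioo (0 : ℝ) 1) := by
  have h := integrableOn_VaR hY hi
  have h2 : IntegrableOn (fun _ : ℝ => x) (Set.Ioo (0 : ℝ) 1) := by simp
  exact (Integrable.sub h h2).pos_part

lemma mul_ES_sub {a : ℝ} (hY : Measurable Y) (hi : Integrable Y P) (h0 : 0 < a) (h1 : a < 1)
    (x : ℝ) : a * ES P a Y - a * x = ∫ β in Set.Ioo (0 : ℝ) a, (VaR P β Y - x) := by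
  have hsub : Set.Ioo (0 : ℝ) a ⊆ Set.Ioo 0 1 := Set.Ioo_subset_Ioo_right h1.le
  rw [mul_ES_eq h0, integral_sub ((integrableOn_VaR hY hi).mono_set hsub) (by simp)]
  simp [h0.le]

/-- Passing to the positive part and then enlarging (0, a) to (0, 1) can only increase the integral
of VaR_β − x. -/
lemma mul_ES_le {a : ℝ} (hY : Measurable Y) (hi : Integrable Y P) (h0 : 0 < a) (h1 : a < 1)
    (x : ℝ) : a * ES P a Y ≤ a * x + stopLoss P Y x := by
  have hsub : Set.Ioo (0 : ℝ) a ⊆ Set.Ioo 0 1 := Set.Ioo_subset_Ioo_right h1.le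
  have h2 : IntegrableOn (fun _ : ℝ => x) (Set.Ioo (0 : ℝ) a) := by simp
  have key : a * ES P a Y - a * x ≤ stopLoss P Y x := by
    rw [mul_ES_sub hY hi h0 h1, ← setIntegral_VaR_excess hY]
    calc ∫ β in Set.Ioo (0 : ℝ) a, (VaR P β Y - x)
        ≤ ∫ β in Set.Ioo (0 : ℝ) a, max (VaR P β Y - x) 0 :=
          integral_mono (Integrable.sub ((integrableOn_VaR hY hi).mono_set hsub) h2)
            ((integrableOn_VaR_excess hY hi x).mono_set hsub) fun β => le_max_left _ _
      _ ≤ ∫ β in Set.Ioo (0 : ℝ) 1, max (VaR P β Y - x) 0 :=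
          setIntegral_mono_set (integrableOn_VaR_excess hY hi x)
            (Eventually.of_forall fun _ => le_max_right _ _) hsub.eventuallyLE
  linarith

/-- At x = VaR_a both losses in `mul_ES_le` disappear: by monotonicity VaR_β − x is nonnegative for
β < a and nonpositive for β ≥ a. -/
lemma mul_ES_eq_VaR {a : ℝ} (hY : Measurable Y) (hi : Integrable Y P) (h0 : 0 < a) (h1 : a < 1) :
    a * ES P a Y = a * VaR P a Y + stopLoss P Y (VaR P a Y) := by
  have hsub : Set.Ioo (0 : ℝ) a ⊆ Set.Ioo 0 1 := Set.Ioo_subset_Ioo_right h1.le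
  set x := VaR P a Y with hx
  have key : a * ES P a Y - a * x = stopLoss P Y x := by
    rw [mul_ES_sub hY hi h0 h1, ← setIntegral_VaR_excess hY]
    rw [setIntegral_eq_of_subset_of_forall_sdiff_eq_zero measurableSet_Ioo hsub]
    · refine setIntegral_congr_fun measurableSet_Ioo fun β hβ => ?_
      have : x ≤ VaR P β Y := VaR_antitoneOn hY (hsub hβ) ⟨h0, h1⟩ hβ.2.le
      exact (max_eq_left (by linarith)).symm
    · intro β hβ
      have hle : a ≤ β := by
        by_contra! h
        exact hβ.2 ⟨hβ.1.1, h⟩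
      have : VaR P β Y ≤ x := VaR_antitoneOn hY ⟨h0, h1⟩ hβ.1 hle
      exact max_eq_right (sub_nonpos.2 this)
  linarith

lemma VaR_le_ES {a : ℝ} (hY : Measurable Y) (hi : Integrable Y P) (h0 : 0 < a) (h1 : a < 1) :
    VaR P a Y ≤ ES P a Y := by
  have := mul_ES_eq_VaR hY hi h0 h1
  have h2 := stopLoss_nonneg (P := P) (Y := Y) (VaR P a Y)
  exact le_of_mul_le_mul_left (by linarith) h0

/-- This form needs only a witness x, which makes subadditivity, monotonicity in the level and
measurability accessible without quantiles. -/
lemma ES_le_iff {a m : ℝ} (hY : Measurable Y) (hi : Integrable Y P) (h0 : 0 < a) (h1 : a < 1) :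
    ES P a Y ≤ m ↔ ∃ x, a * x + stopLoss P Y x ≤ a * m := by
  constructor
  · intro h
    exact ⟨VaR P a Y, by rw [← mul_ES_eq_VaR hY hi h0 h1]; gcongr⟩
  · rintro ⟨x, hx⟩
    exact le_of_mul_le_mul_left ((mul_ES_le hY hi h0 h1 x).trans hx) h0

lemma continuousOn_mul_ES (hY : Measurable Y) (hi : Integrable Y P) :
    ContinuousOn (fun b => b * ES P b Y) (Set.Ioo (0 : ℝ) 1) := by
  have hint : IntegrableOn (fun β => VaR P β Y) (Set.Icc (0 : ℝ) 1) :=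
    (integrableOn_Icc_iff_integrableOn_Ioo (by simp) (by simp)).2 (integrableOn_VaR hY hi)
  have h := (intervalIntegral.continuousOn_primitive_Icc (a := 0) (b := 1) (by simpa using hint))
  refine (h.mono Set.Ioo_subset_Icc_self).congr fun b hb => ?_
  simp only [mul_ES_eq hb.1, integral_Icc_eq_integral_Ioo]

end Quantile

end DQ
namespace DQ

/-! ### Consequences of a tail density. -/

section Basic

variable {Ω : Type*} [MeasurableSpace Ω] {P : Measure Ω}

lemma integral_indicator_gt {Y : Ω → ℝ} (hY : Measurable Y) (x : ℝ) :
    ∫ ω, {ω | x < Y ω}.indicator (fun _ => (1 : ℝ)) ω ∂P = P.real {ω | x < Y ω} :=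
  integral_indicator_one (measurableSet_lt measurable_const hY)

variable {n : ℕ} {X : Ω → Fin n → ℝ}

lemma integrable_total (hi : ∀ i, Integrable (fun ω => X ω i) P) : Integrable (total X) P :=
  integrable_finsetSum _ fun i _ => hi i

lemma levelSet_bddBelow {α : ℝ} : BddBelow (levelSet P α X) := ⟨0, fun _ hb => hb.1.1.le⟩

lemma HasDensityOn.measure_singleton {ν : Measure ℝ} {f : ℝ → ℝ} {A : Set ℝ}
    (h : HasDensityOn ν f A) {t : ℝ} (ht : t ∈ A) : ν {t} = 0 := by
  have h1 : ν.restrict A {t} = 0 := by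
    rw [h.2.2]
    refine withDensity_absolutelyContinuous _ _ ?_
    exact le_antisymm ((Measure.restrict_apply_le A {t}).trans (by simp)) zero_le
  rwa [Measure.restrict_apply (measurableSet_singleton t),
    Set.inter_eq_left.2 (Set.singleton_subset_iff.2 ht)] at h1

lemma HasDensityOn.measure_Ioc_ne_zero {ν : Measure ℝ} {f : ℝ → ℝ} {A : Set ℝ} {t d : ℝ}
    (h : HasDensityOn ν f A) (hA : Set.Ici t ⊆ A) (hf : ∀ x ∈ Set.Ici t, 0 < f x) (hd : 0 < d) :
    ν (Set.Ioc t (t + d)) ≠ 0 := by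
  have hsub : Set.Ioc t (t + d) ⊆ Set.Ici t := fun x hx => hx.1.le
  intro h0
  have h1 : ν.restrict A (Set.Ioc t (t + d)) = 0 :=
    le_antisymm ((Measure.restrict_apply_le A _).trans h0.le) zero_le
  rw [h.2.2, withDensity_apply_eq_zero (by have := h.1; fun_prop)] at h1
  have h2 : {x | ENNReal.ofReal (f x) ≠ 0} ∩ Set.Ioc t (t + d) = Set.Ioc t (t + d) := by
    refine Set.inter_eq_right.2 fun x hx => ?_
    simpa using hf x (hsub hx)
  rw [h2, Measure.restrict_apply measurableSet_Ioc, Set.inter_eq_left.2 (hsub.trans hA),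
    Real.volume_Ioc] at h1
  simp at h1
  linarith

end Basic

/-! ### Convexity of the stop-loss transform and localization of its minimizer. -/

section Convexity

variable {Ω : Type*} [MeasurableSpace Ω] {P : Measure Ω} [IsProbabilityMeasure P] {Y : Ω → ℝ}

lemma integrable_indicator_gt (hY : Measurable Y) (x : ℝ) :
    Integrable ({ω | x < Y ω}.indicator fun _ => (1 : ℝ)) P :=
  (integrable_const 1).indicator (measurableSet_lt measurable_const hY)

lemma convexOn_stopLoss (hi : Integrable Y P) (a : ℝ) :
    ConvexOn ℝ Set.univ fun x => a * x + stopLoss P Y x := by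
  refine ⟨convex_univ, fun x _ y _ c d hc hd hcd => ?_⟩
  have key : stopLoss P Y (c * x + d * y) ≤ c * stopLoss P Y x + d * stopLoss P Y y := by
    simp only [stopLoss]
    rw [← integral_const_mul, ← integral_const_mul, ← integral_add
      ((integrable_excess hi x).const_mul c) ((integrable_excess hi y).const_mul d)]
    refine integral_mono (integrable_excess hi _)
      (((integrable_excess hi x).const_mul c).add ((integrable_excess hi y).const_mul d))
      fun ω => ?_
    have h1 := mul_le_mul_of_nonneg_left (le_max_left (Y ω - x) 0) hc
    have h2 := mul_le_mul_of_nonneg_left (le_max_left (Y ω - y) 0) hd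
    have h3 := mul_nonneg hc (le_max_right (Y ω - x) 0)
    have h4 := mul_nonneg hd (le_max_right (Y ω - y) 0)
    refine max_le ?_ (add_nonneg h3 h4)
    have : Y ω = c * Y ω + d * Y ω := by rw [← add_mul, hcd, one_mul]
    simp only
    linarith
  simp only [smul_eq_mul]
  nlinarith [key]

/-- Pointwise, −1{Y > t} is a subgradient at t of the convex function x ↦ (Y − x)₊; integrate. -/
lemma stopLoss_subgradient (hY : Measurable Y) (hi : Integrable Y P) (t x : ℝ) :
    stopLoss P Y t - (x - t) * P.real {ω | t < Y ω} ≤ stopLoss P Y x := by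
  rw [← integral_indicator_gt hY, ← integral_const_mul, stopLoss, stopLoss, ← integral_sub
    (integrable_excess hi t) ((integrable_indicator_gt hY t).const_mul _)]
  refine integral_mono ((integrable_excess hi t).sub ((integrable_indicator_gt hY t).const_mul _))
    (integrable_excess hi x) fun ω => ?_
  by_cases h : t < Y ω
  · simp only [Set.indicator, Set.mem_ofPred_eq, h, if_true, max_eq_left (sub_pos.2 h).le]
    exact le_trans (by linarith) (le_max_left _ _)
  · simp only [Set.indicator, Set.mem_ofPred_eq, h, if_false,
      max_eq_right (sub_nonpos.2 (not_lt.1 h))]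
    simp

/-- If the convex function `x ↦ a x + E (Y - x)₊` is at `t` not larger than at `t ± δ`, then `t`
minimizes it up to the error `δ |a - P (Y > t)|`. -/
lemma near_minimizer {a t δ : ℝ} (hY : Measurable Y) (hi : Integrable Y P) (hδ : 0 < δ)
    (hr : a * t + stopLoss P Y t ≤ a * (t + δ) + stopLoss P Y (t + δ))
    (hl : a * t + stopLoss P Y t ≤ a * (t - δ) + stopLoss P Y (t - δ)) (x : ℝ) :
    a * t + stopLoss P Y t - δ * |a - P.real {ω | t < Y ω}| ≤ a * x + stopLoss P Y x := by
  have hc := convexOn_stopLoss (P := P) hi a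
  have hpos : 0 ≤ δ * |a - P.real {ω | t < Y ω}| := by positivity
  -- Outside [t − δ, t + δ] convexity propagates the inequality at t ± δ outwards; inside, the
  -- subgradient at t costs at most δ times the slope.
  rcases lt_or_ge (t + δ) x with h | h
  · have := hc.le_right_of_left_le (Set.mem_univ t) (Set.mem_univ x) (z := t + δ)
      (by rw [openSegment_eq_Ioo (by linarith)]; constructor <;> linarith) hr
    linarith
  rcases lt_or_ge x (t - δ) with h' | h'
  · have := hc.le_left_of_right_le (Set.mem_univ x) (Set.mem_univ t) (z := t - δ)
      (by rw [openSegment_eq_Ioo (by linarith)]; constructor <;> linarith) hl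
    linarith
  have h1 := stopLoss_subgradient (P := P) hY hi t x
  have h2 : |(a - P.real {ω | t < Y ω}) * (x - t)| ≤ |a - P.real {ω | t < Y ω}| * δ := by
    rw [abs_mul]
    exact mul_le_mul_of_nonneg_left (abs_le.2 ⟨by linarith, by linarith⟩) (abs_nonneg _)
  have h3 := neg_le_of_abs_le h2
  linarith

/-- Two-sided bound of the expected shortfall around an approximate quantile. -/
lemma mul_ES_ge {a t δ : ℝ} (hY : Measurable Y) (hi : Integrable Y P) (h0 : 0 < a) (h1 : a < 1)
    (hδ : 0 < δ)
    (hr : a * t + stopLoss P Y t ≤ a * (t + δ) + stopLoss P Y (t + δ))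
    (hl : a * t + stopLoss P Y t ≤ a * (t - δ) + stopLoss P Y (t - δ)) :
    a * t + stopLoss P Y t - δ * |a - P.real {ω | t < Y ω}| ≤ a * ES P a Y := by
  rw [mul_ES_eq_VaR hY hi h0 h1]
  exact near_minimizer hY hi hδ hr hl _

/-- Pointwise, moving from t to t + δ lowers the excess by at most δ/2·1{Y > t} + δ/2·1{Y > t +
δ/2}. The mean of this is below aδ because the second probability is below a. -/
lemma lt_right_of_measure_lt {a t δ : ℝ} (hY : Measurable Y) (hi : Integrable Y P) (hδ : 0 < δ)
    (h1 : P.real {ω | t < Y ω} = a) (h2 : P.real {ω | t + δ / 2 < Y ω} < a) :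
    a * t + stopLoss P Y t < a * (t + δ) + stopLoss P Y (t + δ) := by
  have key : stopLoss P Y t ≤ stopLoss P Y (t + δ) + (δ / 2 * P.real {ω | t < Y ω}
      + δ / 2 * P.real {ω | t + δ / 2 < Y ω}) := by
    have i1 := (integrable_indicator_gt (P := P) hY t).const_mul (δ / 2)
    have i2 := (integrable_indicator_gt (P := P) hY (t + δ / 2)).const_mul (δ / 2)
    rw [← integral_indicator_gt hY, ← integral_indicator_gt hY, ← integral_const_mul,
      ← integral_const_mul, stopLoss, stopLoss, ← integral_add i1 i2,
      ← integral_add (integrable_excess hi _) (by exact i1.add i2)]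
    refine integral_mono (integrable_excess hi _) ((integrable_excess hi _).add (i1.add i2))
      fun ω => ?_
    have h0 := le_max_right (Y ω - (t + δ)) 0
    have h3 := le_max_left (Y ω - (t + δ)) 0
    simp only [Set.indicator, Set.mem_ofPred_eq]
    refine max_le ?_ ?_ <;> split_ifs <;> linarith
  nlinarith [mul_lt_mul_of_pos_left h2 (half_pos hδ)]

lemma lt_left_of_lt_measure {a t δ : ℝ} (hY : Measurable Y) (hi : Integrable Y P) (hδ : 0 < δ)
    (h1 : P.real {ω | t < Y ω} = a) (h2 : a < P.real {ω | t - δ / 2 < Y ω}) :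
    a * t + stopLoss P Y t < a * (t - δ) + stopLoss P Y (t - δ) := by
  have key : stopLoss P Y t + (δ / 2 * P.real {ω | t < Y ω}
      + δ / 2 * P.real {ω | t - δ / 2 < Y ω}) ≤ stopLoss P Y (t - δ) := by
    have i1 := (integrable_indicator_gt (P := P) hY t).const_mul (δ / 2)
    have i2 := (integrable_indicator_gt (P := P) hY (t - δ / 2)).const_mul (δ / 2)
    rw [← integral_indicator_gt hY, ← integral_indicator_gt hY, ← integral_const_mul,
      ← integral_const_mul, stopLoss, stopLoss, ← integral_add i1 i2,
      ← integral_add (integrable_excess hi _) (by exact i1.add i2)]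
    refine integral_mono ((integrable_excess hi _).add (i1.add i2)) (integrable_excess hi _)
      fun ω => ?_
    have h0 := le_max_right (Y ω - (t - δ)) 0
    have h3 := le_max_left (Y ω - (t - δ)) 0
    simp only [Set.indicator, Set.mem_ofPred_eq]
    rcases max_cases (Y ω - t) 0 with ⟨h, _⟩ | ⟨h, _⟩ <;> rw [h] <;> split_ifs <;> linarith
  nlinarith [mul_lt_mul_of_pos_left h2 (half_pos hδ)]

end Convexity

/-! ### The quantile as strict minimizer. -/

section Density

variable {Ω : Type*} [MeasurableSpace Ω] {P : Measure Ω} [IsProbabilityMeasure P] {Y : Ω → ℝ}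

lemma measure_gt_eq_one_sub (hY : Measurable Y) (x : ℝ) :
    P.real {ω | x < Y ω} = 1 - P.real {ω | Y ω ≤ x} := by
  rw [← probReal_compl_eq_one_sub (measurableSet_le hY measurable_const)]
  congr 1; ext; simp

/-- Below the quantile the distribution function stays under 1 − a, hence so does its left limit
there; without an atom this limit is the value itself. -/
lemma measure_gt_VaR {a : ℝ} (hY : Measurable Y) (h0 : 0 < a) (h1 : a < 1)
    (hatom : P.map Y {VaR P a Y} = 0) : P.real {ω | VaR P a Y < Y ω} = a := by
  have hP := Measure.isProbabilityMeasure_map (μ := P) hY.aemeasurable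
  have hge := (VaR_le_iff (P := P) hY h0 h1 _).1 le_rfl
  set t := VaR P a Y with ht
  rw [measure_gt_eq_one_sub hY]
  rw [← cdf_map_eq hY] at hge ⊢
  rw [← measure_cdf (P.map Y), StieltjesFunction.measure_singleton, ENNReal.ofReal_eq_zero] at hatom
  have hlim : Function.leftLim (cdf (P.map Y)) t ≤ 1 - a := by
    refine le_of_tendsto ((monotone_cdf (P.map Y)).tendsto_leftLim t) ?_
    filter_upwards [self_mem_nhdsWithin] with x hx
    by_contra! hlt
    rw [cdf_map_eq hY] at hlt
    exact absurd ((VaR_le_iff hY h0 h1 x).2 hlt.le) (not_le.2 hx)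
  linarith

lemma lt_measure_gt_of_lt_VaR {a x : ℝ} (hY : Measurable Y) (h0 : 0 < a) (h1 : a < 1)
    (hx : x < VaR P a Y) : a < P.real {ω | x < Y ω} := by
  rw [measure_gt_eq_one_sub hY]
  have := mt (VaR_le_iff (P := P) hY h0 h1 x).2 (not_le.2 hx)
  linarith

lemma measure_gt_lt_of_density {a t d : ℝ} (hY : Measurable Y) {f : ℝ → ℝ} {A : Set ℝ}
    (h : HasDensityOn (P.map Y) f A) (hA : Set.Ici t ⊆ A) (hf : ∀ x ∈ Set.Ici t, 0 < f x)
    (hd : 0 < d) (hta : P.real {ω | t < Y ω} = a) : P.real {ω | t + d < Y ω} < a := by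
  have h2 := h.measure_Ioc_ne_zero hA hf hd
  rw [Measure.map_apply hY measurableSet_Ioc] at h2
  have h3 : 0 < P.real (Y ⁻¹' Set.Ioc t (t + d)) :=
    ENNReal.toReal_pos h2 (measure_ne_top _ _)
  have h4 : P.real {ω | t < Y ω}
      = P.real (Y ⁻¹' Set.Ioc t (t + d)) + P.real {ω | t + d < Y ω} := by
    rw [← measureReal_union _ (measurableSet_lt measurable_const hY)]
    · congr 1
      ext ω
      simp only [Set.mem_ofPred_eq, Set.mem_union, Set.mem_preimage, Set.mem_Ioc]
      constructor
      · intro h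
        rcases le_or_gt (Y ω) (t + d) with h' | h'
        · exact Or.inl ⟨h, h'⟩
        · exact Or.inr h'
      · rintro (h | h)
        · exact h.1
        · linarith
    · rw [Set.disjoint_left]
      intro ω h1 h2
      exact absurd h1.2 (not_le.2 h2)
  linarith

/-- With a density that is positive to the right of the quantile, the quantile is the strict
minimizer of the Rockafellar-Uryasev function. -/
lemma strict_minimizer {a : ℝ} (hY : Measurable Y) (hi : Integrable Y P) (h0 : 0 < a) (h1 : a < 1)
    {f : ℝ → ℝ} {A : Set ℝ} (h : HasDensityOn (P.map Y) f A) (hA : Set.Ici (VaR P a Y) ⊆ A)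
    (hf : ∀ x ∈ Set.Ici (VaR P a Y), 0 < f x) {δ : ℝ} (hδ : 0 < δ) :
    a * VaR P a Y + stopLoss P Y (VaR P a Y)
        < a * (VaR P a Y + δ) + stopLoss P Y (VaR P a Y + δ) ∧
      a * VaR P a Y + stopLoss P Y (VaR P a Y)
        < a * (VaR P a Y - δ) + stopLoss P Y (VaR P a Y - δ) := by
  have hta := measure_gt_VaR hY h0 h1 (h.measure_singleton (hA Set.self_mem_Ici))
  exact ⟨lt_right_of_measure_lt hY hi hδ hta
      (measure_gt_lt_of_density hY h hA hf (half_pos hδ) hta),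
    lt_left_of_lt_measure hY hi hδ hta (lt_measure_gt_of_lt_VaR hY h0 h1 (by linarith))⟩

end Density

/-! ### The level set and α*. -/

section LevelSet

variable {Ω : Type*} [MeasurableSpace Ω] {P : Measure Ω} [IsProbabilityMeasure P]
  {n : ℕ} {X : Ω → Fin n → ℝ} {α : ℝ}

lemma measurable_total (hX : Measurable X) : Measurable (total X) := by
  unfold total; fun_prop

lemma stopLoss_total_le (hi : ∀ i, Integrable (fun ω => X ω i) P) (t : Fin n → ℝ) :
    stopLoss P (total X) (∑ i, t i) ≤ ∑ i, stopLoss P (fun ω => X ω i) (t i) := by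
  simp only [stopLoss]
  rw [← integral_finsetSum _ fun i _ => integrable_excess (hi i) (t i)]
  refine integral_mono (integrable_excess (integrable_total hi) _)
    (integrable_finsetSum _ fun i _ => integrable_excess (hi i) (t i)) fun ω => ?_
  refine max_le ?_ (Finset.sum_nonneg fun i _ => le_max_right _ _)
  simp only [total, ← Finset.sum_sub_distrib]
  exact Finset.sum_le_sum fun i _ => le_max_left _ _

/-- Subadditivity of the expected shortfall: the level `α` itself belongs to the level set. -/
lemma mem_levelSet_self (hX : Measurable X) (hi : ∀ i, Integrable (fun ω => X ω i) P)
    (h0 : 0 < α) (h1 : α < 1) : α ∈ levelSet P α X := by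
  refine ⟨⟨h0, h1⟩, ?_⟩
  rw [ES_le_iff (measurable_total hX) (integrable_total hi) h0 h1]
  -- The sum of the individual quantiles need not be optimal for S, but the positive part is
  -- subadditive, which is enough.
  refine ⟨∑ i, VaR P α (fun ω => X ω i), ?_⟩
  have h := stopLoss_total_le hi fun i => VaR P α (fun ω => X ω i)
  rw [Finset.mul_sum, Finset.mul_sum]
  have h2 : ∀ i, α * ES P α (fun ω => X ω i) = _ := fun i =>
    mul_ES_eq_VaR (measurable_pi_iff.1 hX i) (hi i) h0 h1
  simp only [h2, Finset.sum_add_distrib]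
  linarith

/-- The same x serves every larger level: E(S − x)₊ ≤ b(m − x) with a nonnegative left side forces m
≥ x, so the right side grows with b. -/
lemma levelSet_upward (hX : Measurable X) (hi : ∀ i, Integrable (fun ω => X ω i) P)
    {b c : ℝ} (hb : b ∈ levelSet P α X) (hbc : b ≤ c) (hc : c < 1) : c ∈ levelSet P α X := by
  obtain ⟨⟨h0, h1⟩, h⟩ := hb
  rw [ES_le_iff (measurable_total hX) (integrable_total hi) h0 h1] at h
  obtain ⟨x, hx⟩ := h
  refine ⟨⟨h0.trans_le hbc, hc⟩, ?_⟩
  rw [ES_le_iff (measurable_total hX) (integrable_total hi) (h0.trans_le hbc) hc]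
  refine ⟨x, ?_⟩
  set m := ∑ i, ES P α (fun ω => X ω i)
  have hs := stopLoss_nonneg (P := P) (Y := total X) x
  have hm : 0 ≤ m - x := by
    by_contra! hneg
    nlinarith
  nlinarith

lemma alphaStar_eq_sInf (hX : Measurable X) (hi : ∀ i, Integrable (fun ω => X ω i) P)
    (h0 : 0 < α) (h1 : α < 1) : alphaStar P α X = sInf (levelSet P α X) :=
  if_pos ⟨α, mem_levelSet_self hX hi h0 h1⟩

lemma alphaStar_le (hX : Measurable X) (hi : ∀ i, Integrable (fun ω => X ω i) P)
    (h0 : 0 < α) (h1 : α < 1) {b : ℝ} (hb : b ∈ levelSet P α X) : alphaStar P α X ≤ b := by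
  rw [alphaStar_eq_sInf hX hi h0 h1]
  exact csInf_le levelSet_bddBelow hb

lemma le_alphaStar (hX : Measurable X) (hi : ∀ i, Integrable (fun ω => X ω i) P)
    (h0 : 0 < α) (h1 : α < 1) {b : ℝ} (hb1 : b < 1) (hb : b ∉ levelSet P α X) :
    b ≤ alphaStar P α X := by
  rw [alphaStar_eq_sInf hX hi h0 h1]
  refine le_csInf ⟨α, mem_levelSet_self hX hi h0 h1⟩ fun c hc => ?_
  by_contra! hlt
  exact hb (levelSet_upward hX hi hc hlt.le hb1)

lemma alphaStar_lt_iff (hX : Measurable X) (hi : ∀ i, Integrable (fun ω => X ω i) P)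
    (h0 : 0 < α) (h1 : α < 1) {c : ℝ} :
    alphaStar P α X < c ↔ ∃ b ∈ levelSet P α X, b < c := by
  rw [alphaStar_eq_sInf hX hi h0 h1]
  exact csInf_lt_iff levelSet_bddBelow ⟨α, mem_levelSet_self hX hi h0 h1⟩

/-- Upper bound of `α*` by the value of the fractional objective at any admissible point. -/
lemma alphaStar_le_div (hX : Measurable X) (hi : ∀ i, Integrable (fun ω => X ω i) P)
    (h0 : 0 < α) (h1 : α < 1) {s u B : ℝ} (hu : u = ∑ i, ES P α (fun ω => X ω i) - s)
    (hB : B * u = stopLoss P (total X) s) (hB0 : 0 < B) (hB1 : B < 1) :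
    alphaStar P α X ≤ B := by
  refine alphaStar_le hX hi h0 h1 ⟨⟨hB0, hB1⟩, ?_⟩
  rw [ES_le_iff (measurable_total hX) (integrable_total hi) hB0 hB1]
  exact ⟨s, by rw [← hB, hu]; linarith⟩

/-- Lower bound of `α*` at an approximate minimizer of the fractional objective. -/
lemma le_alphaStar_of_near_minimizer (hX : Measurable X)
    (hi : ∀ i, Integrable (fun ω => X ω i) P) (h0 : 0 < α) (h1 : α < 1) {s u b δ : ℝ}
    (hu : u = ∑ i, ES P α (fun ω => X ω i) - s) (hb0 : 0 < b) (hb1 : b < 1) (hδ : 0 < δ)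
    (hr : b * s + stopLoss P (total X) s ≤ b * (s + δ) + stopLoss P (total X) (s + δ))
    (hl : b * s + stopLoss P (total X) s ≤ b * (s - δ) + stopLoss P (total X) (s - δ))
    (hlt : b * u + δ * |b - P.real {ω | s < total X ω}| < stopLoss P (total X) s) :
    b ≤ alphaStar P α X := by
  refine le_alphaStar hX hi h0 h1 hb1 fun hmem => ?_
  have h := hmem.2
  rw [ES_le_iff (measurable_total hX) (integrable_total hi) hb0 hb1] at h
  obtain ⟨x, hx⟩ := h
  have := near_minimizer (measurable_total hX) (integrable_total hi) hδ hr hl x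
  have h2 : ∑ i, ES P α (fun ω => X ω i) = u + s := by linarith
  rw [h2] at hx
  linarith

/-- The tail probability q = P(S > m) is positive. At a level b < q, VaR_b(S) exceeds m and so does
ES_b(S), hence q bounds the level set from below. -/
lemma alphaStar_pos (hX : Measurable X) (hi : ∀ i, Integrable (fun ω => X ω i) P)
    (h0 : 0 < α) (h1 : α < 1)
    (hunique : ((∑ i, ES P α (fun ω => X ω i) : ℝ) : EReal)
      < essSup (fun ω => ((total X ω : ℝ) : EReal)) P) : 0 < alphaStar P α X := by
  set m := ∑ i, ES P α (fun ω => X ω i) with hm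
  have hq : 0 < P.real {ω | m < total X ω} := by
    by_contra! hle
    have hz : P {ω | m < total X ω} = 0 := by
      have := le_antisymm hle measureReal_nonneg
      rwa [measureReal_eq_zero_iff] at this
    refine absurd hunique (not_lt.2 (essSup_le_of_ae_le _ ?_))
    have : ∀ᵐ ω ∂P, ¬ m < total X ω := by
      rw [ae_iff]; simpa using hz
    filter_upwards [this] with ω hω
    exact_mod_cast not_lt.1 hω
  refine hq.trans_le ?_
  rw [alphaStar_eq_sInf hX hi h0 h1]
  refine le_csInf ⟨α, mem_levelSet_self hX hi h0 h1⟩ fun b hb => ?_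
  by_contra! hlt
  have h2 : m < VaR P b (total X) := by
    by_contra! h3
    rw [VaR_le_iff (measurable_total hX) hb.1.1 hb.1.2] at h3
    rw [measure_gt_eq_one_sub (measurable_total hX)] at hlt
    linarith
  exact absurd hb.2 (not_le.2 (h2.trans_le
    (VaR_le_ES (measurable_total hX) (integrable_total hi) hb.1.1 hb.1.2)))

lemma alphaStar_le_self (hX : Measurable X) (hi : ∀ i, Integrable (fun ω => X ω i) P)
    (h0 : 0 < α) (h1 : α < 1) : alphaStar P α X ≤ α :=
  alphaStar_le hX hi h0 h1 (mem_levelSet_self hX hi h0 h1)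

/-- The level `α*` solves the defining equation `ES_{α*}(S) = ∑ i, ES_α(X_i)`. -/
lemma ES_alphaStar (hX : Measurable X) (hi : ∀ i, Integrable (fun ω => X ω i) P)
    (h0 : 0 < α) (h1 : α < 1) (hpos : 0 < alphaStar P α X) :
    ES P (alphaStar P α X) (total X) = ∑ i, ES P α (fun ω => X ω i) := by
  set m := ∑ i, ES P α (fun ω => X ω i) with hm
  set a := alphaStar P α X with ha
  have ha1 : a < 1 := (alphaStar_le_self hX hi h0 h1).trans_lt h1
  -- Continuity at α* gives one inequality as a limit along the level set and the other as a limit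
  -- from the left, where no level belongs to it.
  have hcont : ContinuousAt (fun b => b * ES P b (total X) - b * m) a :=
    (((continuousOn_mul_ES (measurable_total hX) (integrable_total hi)).continuousAt
      (Ioo_mem_nhds hpos ha1))).sub (by fun_prop)
  have hne : (levelSet P α X).Nonempty := ⟨α, mem_levelSet_self hX hi h0 h1⟩
  apply le_antisymm
  · have hmem : a ∈ closure (levelSet P α X) := by
      rw [ha, alphaStar_eq_sInf hX hi h0 h1]
      exact csInf_mem_closure hne levelSet_bddBelow
    have hnb := mem_closure_iff_nhdsWithin_neBot.1 hmem
    have : a * ES P a (total X) - a * m ≤ 0 := by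
      refine le_of_tendsto (x := nhdsWithin a (levelSet P α X))
        (hcont.tendsto.mono_left nhdsWithin_le_nhds) ?_
      filter_upwards [self_mem_nhdsWithin] with b hb
      have := mul_le_mul_of_nonneg_left hb.2 hb.1.1.le
      linarith
    exact le_of_mul_le_mul_left (by linarith) hpos
  · have : 0 ≤ a * ES P a (total X) - a * m := by
      refine ge_of_tendsto (x := nhdsWithin a (Set.Iio a))
        (hcont.tendsto.mono_left nhdsWithin_le_nhds) ?_
      filter_upwards [Ioo_mem_nhdsLT hpos] with b hb
      have hb' : b ∉ levelSet P α X := fun h =>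
        absurd (alphaStar_le hX hi h0 h1 h) (not_le.2 hb.2)
      have hlt : m < ES P b (total X) := by
        by_contra! h
        exact hb' ⟨⟨hb.1, hb.2.trans ha1⟩, h⟩
      have := mul_le_mul_of_nonneg_left hlt.le hb.1.le
      linarith
    exact le_of_mul_le_mul_left (by linarith) hpos

lemma stopLoss_pos {Y : Ω → ℝ} {t : ℝ} (hi : Integrable Y P)
    (h : 0 < P.real {ω | t < Y ω}) : 0 < stopLoss P Y t := by
  refine (stopLoss_nonneg t).lt_of_ne' fun h0 => ?_
  have h0' := (integral_eq_zero_iff_of_nonneg (fun _ => le_max_right _ _)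
    (integrable_excess hi t)).1 h0
  have : P {ω | t < Y ω} = 0 := by
    have hae : ∀ᵐ ω ∂P, ¬ t < Y ω := by
      filter_upwards [h0'] with ω hω hlt
      have := le_max_left (Y ω - t) 0
      simp only [Pi.zero_apply] at hω
      linarith
    rw [ae_iff] at hae
    simpa using hae
  rw [measureReal_def, this] at h
  simp at h

end LevelSet

end DQ
namespace DQ

/-! ### The empirical measure and measurability of the estimator. -/

section Empirical

variable {n : ℕ}

instance isFiniteMeasure_sum_dirac (x : ℕ → Fin n → ℝ) (N : ℕ) :
    IsFiniteMeasure (∑ k ∈ Finset.range N, Measure.dirac (x k)) :=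
  ⟨by simp⟩

lemma isProbabilityMeasure_empirical (x : ℕ → Fin n → ℝ) {N : ℕ} (hN : N ≠ 0) :
    IsProbabilityMeasure (empiricalMeasure x N) := by
  refine ⟨?_⟩
  simp only [empiricalMeasure, Measure.smul_apply, Measure.coe_finsetSum, Finset.sum_apply,
    measure_univ, Finset.sum_const, Finset.card_range, smul_eq_mul, nsmul_eq_mul, mul_one]
  exact ENNReal.inv_mul_cancel (by exact_mod_cast hN) (ENNReal.natCast_ne_top N)

lemma integrable_empirical (x : ℕ → Fin n → ℝ) {N : ℕ} (hN : N ≠ 0) (f : (Fin n → ℝ) → ℝ) :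
    Integrable f (empiricalMeasure x N) := by
  refine Integrable.smul_measure ?_ (ENNReal.inv_ne_top.2 (by exact_mod_cast hN))
  exact integrable_finsetSum_measure.2 fun k _ => integrable_dirac (by simp)

lemma integral_empirical (x : ℕ → Fin n → ℝ) (N : ℕ) (f : (Fin n → ℝ) → ℝ) :
    ∫ y, f y ∂(empiricalMeasure x N) = (∑ k ∈ Finset.range N, f (x k)) / N := by
  rw [empiricalMeasure, integral_smul_measure, integral_finsetSum_measure
    fun k _ => integrable_dirac (by simp)]
  simp [div_eq_inv_mul]

lemma stopLoss_empirical (x : ℕ → Fin n → ℝ) (N : ℕ) (Y : (Fin n → ℝ) → ℝ) (t : ℝ) :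
    stopLoss (empiricalMeasure x N) Y t = (∑ k ∈ Finset.range N, max (Y (x k) - t) 0) / N :=
  integral_empirical x N _

lemma measure_gt_empirical (x : ℕ → Fin n → ℝ) (N : ℕ) {Y : (Fin n → ℝ) → ℝ} (hY : Measurable Y)
    (t : ℝ) : (empiricalMeasure x N).real {y | t < Y y}
      = (∑ k ∈ Finset.range N, {y | t < Y y}.indicator (fun _ => (1 : ℝ)) (x k)) / N := by
  rw [← integral_indicator_gt hY, integral_empirical]

lemma stopLoss_antitone {Ω : Type*} [MeasurableSpace Ω] {P : Measure Ω} [IsFiniteMeasure P]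
    {Y : Ω → ℝ} (hi : Integrable Y P) : Antitone (stopLoss P Y) := by
  intro x y hxy
  refine integral_mono ((hi.sub (integrable_const y)).pos_part)
    ((hi.sub (integrable_const x)).pos_part) fun ω => ?_
  exact max_le_max_right 0 (by simp only; linarith)

variable {Ω : Type*} [MeasurableSpace Ω] {Xs : ℕ → Ω → Fin n → ℝ}

lemma measurable_ES_empirical (hXs : ∀ k, Measurable (Xs k)) {N : ℕ} (hN : N ≠ 0)
    {Y : (Fin n → ℝ) → ℝ} (hY : Measurable Y) {a : ℝ} (h0 : 0 < a) (h1 : a < 1) :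
    Measurable fun ω => ES (empiricalMeasure (fun k => Xs k ω) N) a Y := by
  refine measurable_of_Iio fun m => ?_
  -- Since the stop-loss is antitone and the inequality strict, the minimizer can be rounded up to a
  -- rational, leaving a countable union.
  have hset : (fun ω => ES (empiricalMeasure (fun k => Xs k ω) N) a Y) ⁻¹' Set.Iio m
      = ⋃ q : ℚ, {ω | a * (q : ℝ) +
        (∑ k ∈ Finset.range N, max (Y (Xs k ω) - q) 0) / N < a * m} := by
    ext ω
    have := isProbabilityMeasure_empirical (fun k => Xs k ω) hN
    have hi := integrable_empirical (fun k => Xs k ω) hN Y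
    simp only [Set.mem_preimage, Set.mem_Iio, Set.mem_iUnion, Set.mem_ofPred_eq,
      ← stopLoss_empirical (fun k => Xs k ω)]
    constructor
    · intro h
      have h2 := mul_lt_mul_of_pos_left h h0
      rw [mul_ES_eq_VaR hY hi h0 h1] at h2
      set v := VaR (empiricalMeasure (fun k => Xs k ω) N) a Y
      set L := stopLoss (empiricalMeasure (fun k => Xs k ω) N) Y v with hL
      obtain ⟨q, hq1, hq2⟩ := exists_rat_btwn (show v < m - L / a by
        rw [lt_sub_iff_add_lt, ← sub_pos]
        have : m - (v + L / a) = (a * m - (a * v + L)) / a := by field_simp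
        rw [this]; exact div_pos (by linarith) h0)
      refine ⟨q, ?_⟩
      have h3 : stopLoss (empiricalMeasure (fun k => Xs k ω) N) Y q ≤ L :=
        stopLoss_antitone hi hq1.le
      have h4 := mul_lt_mul_of_pos_left hq2 h0
      have h5 : a * (m - L / a) = a * m - L := by field_simp
      linarith
    · rintro ⟨q, hq⟩
      exact lt_of_mul_lt_mul_left ((mul_ES_le hY hi h0 h1 q).trans_lt hq) h0.le
  rw [hset]
  refine MeasurableSet.iUnion fun q => measurableSet_lt ?_ measurable_const
  refine Measurable.const_add (Measurable.div_const ?_ _) _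
  exact Finset.measurable_sum _ fun k _ =>
    ((hY.comp (hXs k)).sub_const _).max measurable_const

lemma measurable_alphaStar_empirical (hXs : ∀ k, Measurable (Xs k)) {N : ℕ} (hN : N ≠ 0)
    {α : ℝ} (h0 : 0 < α) (h1 : α < 1) :
    Measurable fun ω => alphaStar (empiricalMeasure (fun k => Xs k ω) N) α
      (fun y : Fin n → ℝ => y) := by
  refine measurable_of_Iio fun c => ?_
  -- Upward closedness of the level set allows rational levels only.
  have hset : (fun ω => alphaStar (empiricalMeasure (fun k => Xs k ω) N) α
        (fun y : Fin n → ℝ => y)) ⁻¹' Set.Iio c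
      = ⋃ q : {q : ℚ // ((q : ℝ) ∈ Set.Ioo (0 : ℝ) 1) ∧ (q : ℝ) < c},
        {ω | ES (empiricalMeasure (fun k => Xs k ω) N) (q.1 : ℝ) (total fun y : Fin n → ℝ => y)
          ≤ ∑ i, ES (empiricalMeasure (fun k => Xs k ω) N) α fun y : Fin n → ℝ => y i} := by
    ext ω
    have := isProbabilityMeasure_empirical (fun k => Xs k ω) hN
    have hi : ∀ i, Integrable (fun y : Fin n → ℝ => y i)
      (empiricalMeasure (fun k => Xs k ω) N) := fun i => integrable_empirical _ hN _
    simp only [Set.mem_preimage, Set.mem_Iio, Set.mem_iUnion, Set.mem_ofPred_eq]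
    rw [alphaStar_lt_iff measurable_id' hi h0 h1]
    constructor
    · rintro ⟨b, hb, hbc⟩
      obtain ⟨q, hq1, hq2⟩ := exists_rat_btwn (lt_min hbc hb.1.2)
      have hmem := levelSet_upward measurable_id' hi hb hq1.le (hq2.trans_le (min_le_right _ _))
      exact ⟨⟨q, hmem.1, hq2.trans_le (min_le_left _ _)⟩, hmem.2⟩
    · rintro ⟨⟨q, hq, hqc⟩, h⟩
      exact ⟨q, ⟨hq, h⟩, hqc⟩
  rw [hset]
  refine MeasurableSet.iUnion fun q => measurableSet_le ?_ ?_
  · exact measurable_ES_empirical hXs hN (measurable_total measurable_id') q.2.1.1 q.2.1.2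
  · exact Finset.measurable_sum _ fun i _ =>
      measurable_ES_empirical hXs hN (measurable_pi_apply i) h0 h1

lemma measurable_empiricalDQES (hXs : ∀ k, Measurable (Xs k)) {α : ℝ} (h0 : 0 < α) (h1 : α < 1)
    (N : ℕ) : Measurable fun ω => empiricalDQES α (fun k => Xs k ω) N := by
  rcases eq_or_ne N 0 with rfl | hN
  -- For N = 0 the factor is ∞ but multiplies an empty sum: the measure is 0 and the estimator is
  -- constant.
  · simp only [empiricalDQES, empiricalMeasure, Finset.range_zero, Finset.sum_empty, smul_zero]
    exact measurable_const
  · exact (measurable_alphaStar_empirical hXs hN h0 h1).div_const α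

end Empirical

/-! ### Algebra of the linearization error. -/

section Sequences

/-- Here `r` is √N, `uN` the empirical m − s, `A` the empirical stop-loss at s, `p` the empirical
tail probability, `D` the error of freezing the t_i, `Z` the mean influence and `x` the empirical
α*. Then B − a = (Z + aD)/uN, where `D` carries a factor δ, and `x` lies below `B` by a gap that
also carries δ. -/
lemma remainder_bound {r A uN u a p D Z B x δ α T η : ℝ} (hr : 0 ≤ r) (hα : 0 < α) (ha : 0 < a)
    (hu : 0 < u) (hδ : 0 < δ) (hδ1 : δ ≤ 1) (hT : 0 ≤ T)
    (hD : r * |D| ≤ δ / α * T) (hZ : r * |Z| ≤ T) (hp : r * |p - a| ≤ T)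
    (hB : B * uN = A) (hA : A - a * uN = Z + a * D) (huN : u / 2 ≤ uN)
    (hinv : |1 / uN - 1 / u| ≤ δ) (hxB : x ≤ B) (hBx : B - 2 * δ / uN * |B - p| - η ≤ x)
    (hη : r * η ≤ δ * T) :
    |r * (x - a) - r * (Z / u)| ≤
      (4 / u * (2 / u * (1 + a / α) + 1) + 2 + 2 / u * (a / α)) * δ * T := by
  have huN0 : 0 < uN := by linarith
  have hi : 1 / uN ≤ 2 / u := by
    rw [div_le_div_iff₀ huN0 hu]; linarith
  have hi0 : 0 < 1 / uN := by positivity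
  have hBp : B - p = (Z + a * D) * (1 / uN) - (p - a) := by
    rw [← hA, ← hB]; field_simp; ring
  have hDT : r * |D| ≤ 1 / α * T := hD.trans (by gcongr)
  have h1 : r * |B - p| ≤ (2 / u * (1 + a / α) + 1) * T := by
    have : |B - p| ≤ (|Z| + a * |D|) * (1 / uN) + |p - a| := by
      rw [hBp]
      refine (abs_sub _ _).trans ?_
      rw [abs_mul, abs_of_pos hi0]
      gcongr
      refine (abs_add_le _ _).trans ?_
      rw [abs_mul, abs_of_pos ha]
    calc r * |B - p| ≤ r * ((|Z| + a * |D|) * (1 / uN) + |p - a|) := by gcongr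
      _ = (r * |Z| + a * (r * |D|)) * (1 / uN) + r * |p - a| := by ring
      _ ≤ (T + a * (1 / α * T)) * (2 / u) + T := by gcongr
      _ = _ := by ring
  have h2 : |r * (x - B)| ≤ 4 / u * (2 / u * (1 + a / α) + 1) * δ * T + δ * T := by
    rw [abs_mul, abs_of_nonneg hr, abs_sub_comm, abs_of_nonneg (by linarith)]
    calc r * (B - x) ≤ r * (2 * δ * (1 / uN) * |B - p| + η) := by
          gcongr
          have : 2 * δ * (1 / uN) = 2 * δ / uN := by ring
          rw [this]; linarith
      _ = 2 * δ * (1 / uN) * (r * |B - p|) + r * η := by ring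
      _ ≤ 2 * δ * (2 / u) * ((2 / u * (1 + a / α) + 1) * T) + δ * T := by gcongr
      _ = _ := by ring
  have h3 : |r * (B - a) - r * (Z / u)| ≤ δ * T + 2 / u * (a / α) * δ * T := by
    have : r * (B - a) - r * (Z / u)
        = (r * Z) * (1 / uN - 1 / u) + a * (r * D) * (1 / uN) := by
      have : B - a = (Z + a * D) * (1 / uN) := by rw [← hA, ← hB]; field_simp
      rw [this]; ring
    rw [this]
    refine (abs_add_le _ _).trans ?_
    simp only [abs_mul, abs_of_nonneg hr, abs_of_pos ha, abs_of_pos hi0]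
    calc r * |Z| * |1 / uN - 1 / u| + a * (r * |D|) * (1 / uN)
        ≤ T * δ + a * (δ / α * T) * (2 / u) := by gcongr
      _ = _ := by ring
  calc |r * (x - a) - r * (Z / u)|
      = |r * (x - B) + (r * (B - a) - r * (Z / u))| := by congr 1; ring
    _ ≤ _ := (abs_add_le _ _).trans (add_le_add h2 h3)
    _ = _ := by ring

end Sequences

end DQ
namespace DQ

/-! ### Pathwise linearization of the empirical α*. -/

section Linearization

variable {n : ℕ}

/-- The function of one observation whose empirical mean linearizes `α*`. -/
noncomputable def influence (α a s : ℝ) (t : Fin n → ℝ) (y : Fin n → ℝ) : ℝ :=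
  max (total (fun y : Fin n → ℝ => y) y - s) 0 - a * (∑ i, (t i + max (y i - t i) 0 / α) - s)

/-- A stochastically bounded envelope of the fluctuations of the empirical measure. -/
noncomputable def envelope (α a s : ℝ) (t : Fin n → ℝ) (x : ℕ → Fin n → ℝ) (N : ℕ) : ℝ :=
  1 + Real.sqrt N * (|(∑ k ∈ Finset.range N, influence α a s t (x k)) / N|
    + |(empiricalMeasure x N).real {y | s < total (fun y : Fin n → ℝ => y) y} - a|
    + ∑ i, |(empiricalMeasure x N).real {y | t i < y i} - α|)

lemma mean_influence (α a s : ℝ) (t : Fin n → ℝ) (x : ℕ → Fin n → ℝ) {N : ℕ} (hN : N ≠ 0) :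
    (∑ k ∈ Finset.range N, influence α a s t (x k)) / N
      = stopLoss (empiricalMeasure x N) (total fun y : Fin n → ℝ => y) s
        - a * (∑ i, (t i + stopLoss (empiricalMeasure x N) (fun y => y i) (t i) / α) - s) := by
  have hN' : (N : ℝ) ≠ 0 := by exact_mod_cast hN
  simp only [stopLoss_empirical, influence, Finset.sum_sub_distrib, ← Finset.mul_sum,
    Finset.sum_add_distrib, Finset.sum_const, Finset.card_range, nsmul_eq_mul]
  rw [Finset.sum_comm]
  have h : ∀ i, ∑ k ∈ Finset.range N, max (x k i - t i) 0 / α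
      = N * ((∑ k ∈ Finset.range N, max (x k i - t i) 0) / N / α) := fun i => by
    rw [← Finset.sum_div]; field_simp
  simp only [h, ← Finset.mul_sum]
  field_simp

/-- A deterministic statement about one sample path: the laws of large numbers enter as hypotheses,
at the frozen points and their shifts by ±δ. -/
lemma eventually_remainder {x : ℕ → Fin n → ℝ} {α a s u δ : ℝ} {t : Fin n → ℝ}
    {L : Fin n → ℝ → ℝ} {LS : ℝ → ℝ} (hα0 : 0 < α) (hα1 : α < 1) (ha0 : 0 < a) (ha1 : a < 1)
    (hu : 0 < u) (hδ : 0 < δ) (hδ1 : δ ≤ 1) (hδu : 4 * δ < u)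
    (hL0 : ∀ i, Tendsto (fun N => stopLoss (empiricalMeasure x N) (fun y => y i) (t i)) atTop
      (nhds (L i (t i))))
    (hLr : ∀ i, Tendsto (fun N => stopLoss (empiricalMeasure x N) (fun y => y i) (t i + δ)) atTop
      (nhds (L i (t i + δ))))
    (hLl : ∀ i, Tendsto (fun N => stopLoss (empiricalMeasure x N) (fun y => y i) (t i - δ)) atTop
      (nhds (L i (t i - δ))))
    (hp : ∀ i, Tendsto (fun N => (empiricalMeasure x N).real {y | t i < y i}) atTop (nhds α))
    (hS0 : Tendsto (fun N => stopLoss (empiricalMeasure x N) (total fun y : Fin n → ℝ => y) s)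
      atTop (nhds (LS s)))
    (hSr : Tendsto (fun N => stopLoss (empiricalMeasure x N) (total fun y : Fin n → ℝ => y)
      (s + δ)) atTop (nhds (LS (s + δ))))
    (hSl : Tendsto (fun N => stopLoss (empiricalMeasure x N) (total fun y : Fin n → ℝ => y)
      (s - δ)) atTop (nhds (LS (s - δ))))
    (hpS : Tendsto (fun N => (empiricalMeasure x N).real
      {y | s < total (fun y : Fin n → ℝ => y) y}) atTop (nhds a))
    (hr : ∀ i, α * t i + L i (t i) < α * (t i + δ) + L i (t i + δ))
    (hl : ∀ i, α * t i + L i (t i) < α * (t i - δ) + L i (t i - δ))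
    (hrS : a * s + LS s < a * (s + δ) + LS (s + δ))
    (hlS : a * s + LS s < a * (s - δ) + LS (s - δ))
    (hM : ∑ i, (t i + L i (t i) / α) - s = u) (hA : LS s = a * u) :
    ∀ᶠ N : ℕ in atTop, |Real.sqrt N * (alphaStar (empiricalMeasure x N) α
        (fun y : Fin n → ℝ => y) - a) - Real.sqrt N *
        ((∑ k ∈ Finset.range N, influence α a s t (x k)) / N / u)|
      ≤ (4 / u * (2 / u * (1 + a / α) + 1) + 2 + 2 / u * (a / α)) * δ * envelope α a s t x N := by
  set μ := fun N => empiricalMeasure x N with hμ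
  set H := fun N => ∑ i, (t i + stopLoss (μ N) (fun y => y i) (t i) / α) with hH
  set M := fun N => ∑ i, ES (μ N) α (fun y : Fin n → ℝ => y i) with hMdef
  set p := fun N => (μ N).real {y | s < total (fun y : Fin n → ℝ => y) y} with hpdef
  set A := fun N => stopLoss (μ N) (total fun y : Fin n → ℝ => y) s with hAdef
  set V := fun N => ∑ i, |(μ N).real {y | t i < y i} - α| with hV
  have hHlim : Tendsto H atTop (nhds (u + s)) := by
    rw [← hM, sub_add_cancel]
    exact tendsto_finsetSum _ fun i _ => ((hL0 i).div_const α).const_add _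
  have hVlim : Tendsto V atTop (nhds 0) := by
    have : Tendsto V atTop (nhds (∑ i : Fin n, |α - α|)) :=
      tendsto_finsetSum _ fun i _ => ((hp i).sub_const α).abs
    simpa using this
  -- Freezing the t_i in the empirical ES costs only δ times the tail-probability error.
  have hMbound : ∀ᶠ N in atTop, |H N - M N| ≤ δ / α * V N := by
    have e1 : ∀ᶠ N in atTop, ∀ i, α * t i + stopLoss (μ N) (fun y => y i) (t i)
        ≤ α * (t i + δ) + stopLoss (μ N) (fun y => y i) (t i + δ) :=
      eventually_all.2 fun i => (((hL0 i).const_add _).eventually_lt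
        ((hLr i).const_add _) (hr i)).mono fun N h => h.le
    have e2 : ∀ᶠ N in atTop, ∀ i, α * t i + stopLoss (μ N) (fun y => y i) (t i)
        ≤ α * (t i - δ) + stopLoss (μ N) (fun y => y i) (t i - δ) :=
      eventually_all.2 fun i => (((hL0 i).const_add _).eventually_lt
        ((hLl i).const_add _) (hl i)).mono fun N h => h.le
    filter_upwards [e1, e2, eventually_ne_atTop 0] with N h1 h2 hN
    have := isProbabilityMeasure_empirical x hN
    simp only [hH, hMdef, hV, ← Finset.sum_sub_distrib, Finset.mul_sum]
    refine (Finset.abs_sum_le_sum_abs _ _).trans (Finset.sum_le_sum fun i _ => ?_)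
    have hi := integrable_empirical x hN (fun y => y i)
    have h3 := mul_ES_ge (measurable_pi_apply i) hi hα0 hα1 hδ (h1 i) (h2 i)
    have h4 := mul_ES_le (measurable_pi_apply i) hi hα0 hα1 (t i)
    rw [abs_sub_comm α] at h3
    have h5 : t i + stopLoss (μ N) (fun y => y i) (t i) / α - ES (μ N) α (fun y => y i)
        = (α * t i + stopLoss (μ N) (fun y => y i) (t i) - α * ES (μ N) α (fun y => y i)) / α := by
      field_simp
    rw [h5, abs_div, abs_of_pos hα0, div_mul_eq_mul_div]
    gcongr
    rw [abs_of_nonneg (by simp only [hμ]; linarith)]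
    simp only [hμ]
    linarith
  have hMlim : Tendsto M atTop (nhds (u + s)) := by
    have h0 : Tendsto (fun N => H N - M N) atTop (nhds 0) := by
      refine squeeze_zero_norm' hMbound ?_
      simpa using hVlim.const_mul (δ / α)
    simpa using hHlim.sub h0
  have hulim : Tendsto (fun N => M N - s) atTop (nhds u) := by
    simpa using hMlim.sub_const s
  have hBlim : Tendsto (fun N => A N / (M N - s)) atTop (nhds a) := by
    have := hS0.div hulim hu.ne'
    rwa [hA, mul_div_assoc, div_self hu.ne', mul_one] at this
  set B := fun N => A N / (M N - s) with hBdef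
  -- A candidate lower bound slightly below `B`: the middle term pays for the error δ|b − p| of
  -- `near_minimizer`, and 1/N makes the inequality strict while remaining negligible against 1/√N.
  set b := fun N : ℕ => B N - 2 * δ / (M N - s) * |B N - p N| - 1 / (N : ℝ) with hb
  have hblim : Tendsto b atTop (nhds a) := by
    have h1 := ((tendsto_const_nhds (x := 2 * δ)).div hulim hu.ne').mul (hBlim.sub hpS).abs
    have h2 := (hBlim.sub h1).sub (tendsto_one_div_atTop_nhds_zero_nat (𝕜 := ℝ))
    rwa [sub_self, abs_zero, mul_zero, sub_zero, sub_zero] at h2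
  have hinv : ∀ᶠ N in atTop, |1 / (M N - s) - 1 / u| ≤ δ := by
    have h1 : Tendsto (fun N => |1 / (M N - s) - 1 / u|) atTop (nhds |1 / u - 1 / u|) :=
      (((tendsto_const_nhds (x := (1 : ℝ))).div hulim hu.ne').sub_const _).abs
    rw [sub_self, abs_zero] at h1
    exact (h1.eventually_lt_const hδ).mono fun _ h => h.le
  have hsqrt : ∀ᶠ N : ℕ in atTop, 1 / Real.sqrt N ≤ δ := by
    have h1 : Tendsto (fun N : ℕ => 1 / Real.sqrt N) atTop (nhds 0) := by
      simp only [one_div]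
      exact tendsto_inv_atTop_zero.comp (Real.tendsto_sqrt_atTop.comp tendsto_natCast_atTop_atTop)
    exact (h1.eventually_lt_const hδ).mono fun _ h => h.le
  have hrN := ((hblim.mul_const s).add hS0).eventually_lt ((hblim.mul_const (s + δ)).add hSr) hrS
  have hlN := ((hblim.mul_const s).add hS0).eventually_lt ((hblim.mul_const (s - δ)).add hSl) hlS
  filter_upwards [hMbound, hinv, hsqrt, hrN, hlN, eventually_ne_atTop 0,
    hulim.eventually_const_lt (show u / 2 < u by linarith), hBlim.eventually_const_lt ha0,
    hBlim.eventually_lt_const ha1, hblim.eventually_const_lt ha0,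
    hblim.eventually_lt_const ha1] with N hD hiN hsq h1 h2 hN huN hB0 hB1 hb0 hb1
  have := isProbabilityMeasure_empirical x hN
  have hi : ∀ i, Integrable (fun y : Fin n → ℝ => y i) (μ N) :=
    fun i => integrable_empirical x hN _
  have huN0 : 0 < M N - s := by linarith
  have hNr : (0 : ℝ) < N := by exact_mod_cast Nat.pos_of_ne_zero hN
  have hBu : B N * (M N - s) = A N := div_mul_cancel₀ _ huN0.ne'
  have hVN : 0 ≤ V N := Finset.sum_nonneg fun i _ => abs_nonneg _
  have hsn := Real.sqrt_nonneg (N : ℝ)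
  have henv : envelope α a s t x N = 1 + Real.sqrt N *
      (|(∑ k ∈ Finset.range N, influence α a s t (x k)) / N| + |p N - a| + V N) := rfl
  have hZ := abs_nonneg ((∑ k ∈ Finset.range N, influence α a s t (x k)) / N)
  have hP := abs_nonneg (p N - a)
  have m1 := mul_nonneg hsn hZ
  have m2 := mul_nonneg hsn hP
  have m3 := mul_nonneg hsn hVN
  have hT1 : 1 ≤ envelope α a s t x N := by rw [henv, mul_add, mul_add]; linarith
  refine remainder_bound (uN := M N - s) (A := A N) (p := p N) (D := H N - M N) (B := B N)
    (η := 1 / (N : ℝ)) hsn hα0 ha0 hu hδ hδ1 (by linarith) ?_ ?_ ?_ hBu ?_ huN.le hiN ?_ ?_ ?_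
  · calc Real.sqrt N * |H N - M N| ≤ Real.sqrt N * (δ / α * V N) := by gcongr
      _ = δ / α * (Real.sqrt N * V N) := by ring
      _ ≤ _ := by
        gcongr
        rw [henv, mul_add, mul_add]; linarith
  · rw [henv, mul_add, mul_add]; linarith
  · rw [henv, mul_add, mul_add]; linarith
  · rw [mean_influence α a s t x hN]
    simp only [hAdef, hH, hμ]; ring
  · exact alphaStar_le_div measurable_id' hi hα0 hα1 rfl hBu hB0 hB1
  · refine le_alphaStar_of_near_minimizer (δ := δ) (s := s) measurable_id' hi hα0 hα1 rfl hb0 hb1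
      hδ h1.le h2.le ?_
    change b N * (M N - s) + δ * |b N - p N| < A N
    -- From 4δ < u and u/2 < M N − s; it yields |b − p| ≤ 2|B − p| + 1/N, matching the factor 2 in
    -- `b`.
    have hc : δ / (M N - s) ≤ 1 / 2 := by
      rw [div_le_iff₀ huN0]; linarith
    have hq := abs_nonneg (B N - p N)
    have hN1 : 0 < 1 / (N : ℝ) := by positivity
    have h3 : |b N - p N| ≤ 2 * |B N - p N| + 1 / N := by
      have : b N - p N = (B N - p N) - (2 * (δ / (M N - s)) * |B N - p N| + 1 / N) := by
        simp only [hb]; ring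
      rw [this]
      refine (abs_sub _ _).trans ?_
      rw [abs_of_nonneg (a := 2 * (δ / (M N - s)) * |B N - p N| + 1 / (N : ℝ)) (by positivity)]
      nlinarith
    have h4 : b N * (M N - s) = A N - 2 * δ * |B N - p N| - (M N - s) * (1 / N) := by
      rw [← hBu]; simp only [hb]; field_simp
    rw [h4]
    have h5 := mul_le_mul_of_nonneg_left h3 hδ.le
    have h6 : δ * (1 / (N : ℝ)) < (M N - s) * (1 / N) := by gcongr; linarith
    linarith
  · have : Real.sqrt N * (1 / (N : ℝ)) = 1 / Real.sqrt N := by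
      nth_rewrite 2 [← Real.mul_self_sqrt hNr.le]
      have := Real.sqrt_pos.2 hNr
      field_simp
    rw [this]
    nlinarith

end Linearization

end DQ
namespace DQ

/-! ### Law of large numbers. -/

section LawOfLargeNumbers

variable {Ω : Type*} [MeasurableSpace Ω] {P : Measure Ω} {E : Type*} [MeasurableSpace E]
  {X : Ω → E} {Xs : ℕ → Ω → E}

lemma ae_tendsto_mean (hindep : iIndepFun Xs P) (hident : ∀ k, IdentDistrib (Xs k) X P P)
    {w : E → ℝ} (hw : Measurable w) (hi : Integrable (fun ω => w (X ω)) P) :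
    ∀ᵐ ω ∂P, Tendsto (fun N : ℕ => (∑ k ∈ Finset.range N, w (Xs k ω)) / N) atTop
      (nhds (∫ ω, w (X ω) ∂P)) := by
  have hid : ∀ k, IdentDistrib (fun ω => w (Xs k ω)) (fun ω => w (X ω)) P P :=
    fun k => (hident k).comp hw
  have h := strong_law_ae_real (fun k ω => w (Xs k ω)) ((hid 0).integrable_iff.2 hi)
    (fun i j hij => (hindep.comp (fun _ => w) fun _ => hw).indepFun hij)
    fun k => (hid k).trans (hid 0).symm
  rwa [(hid 0).integral_eq] at h

end LawOfLargeNumbers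

/-! ### Negligible remainders, fluctuations and the central limit theorem. -/

section Probability

variable {Ω : Type*} [MeasurableSpace Ω] {P : Measure Ω} [IsProbabilityMeasure P]

/-- A sequence that is eventually dominated by every small multiple of a sequence bounded in `L¹`
tends to zero in probability. -/
lemma tendstoInMeasure_zero_of_eventually_le {R T : ℕ → Ω → ℝ} {C K δ₀ : ℝ}
    (hR : ∀ N, AEStronglyMeasurable (R N) P) (hT : ∀ N, Integrable (T N) P)
    (hT0 : ∀ N ω, 0 ≤ T N ω) (hC : ∀ N, ∫ ω, T N ω ∂P ≤ C) (hK : 0 ≤ K) (hδ₀ : 0 < δ₀)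
    (h : ∀ δ, 0 < δ → δ < δ₀ → ∀ᵐ ω ∂P, ∀ᶠ N in atTop, |R N ω| ≤ K * δ * T N ω) :
    TendstoInMeasure P R atTop (fun _ => 0) := by
  rw [tendstoInMeasure_iff_measureReal_norm]
  intro ε hε
  have hC0 : 0 ≤ C := (integral_nonneg (hT0 0)).trans (hC 0)
  refine (tendsto_order.2 ⟨fun c hc => Eventually.of_forall fun N =>
    hc.trans_le measureReal_nonneg, fun η hη => ?_⟩)
  -- Chosen so that Markov's inequality gives `K * δ * T N` probability at most η/4 of reaching ε/2.
  set δ := min (δ₀ / 2) (ε * η / (8 * ((K + 1) * (C + 1)))) with hδdef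
  have hδ : 0 < δ := lt_min (half_pos hδ₀) (by positivity)
  have hKC : 2 * (K * δ * C) / ε ≤ η / 4 := by
    have h1 : δ * (8 * ((K + 1) * (C + 1))) ≤ ε * η :=
      (le_div_iff₀ (by positivity)).1 (min_le_right _ _)
    have h2 : K * δ * C ≤ δ * ((K + 1) * (C + 1)) := by
      have : 0 ≤ δ * (K + C + 1) := by positivity
      nlinarith
    rw [div_le_iff₀ hε]
    linarith
  -- The part of |R| above its bound is almost surely eventually zero, hence tends to zero in
  -- probability.
  set V : ℕ → Ω → ℝ := fun N ω => max (|R N ω| - K * δ * T N ω) 0 with hV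
  have hVm : ∀ N, AEStronglyMeasurable (V N) P := fun N =>
    ((hR N).norm.sub ((hT N).aestronglyMeasurable.const_mul _)).sup
      aestronglyMeasurable_const
  have hVlim : TendstoInMeasure P V atTop (fun _ => 0) := by
    refine tendstoInMeasure_of_tendsto_ae hVm ?_
    filter_upwards [h δ hδ (lt_of_le_of_lt (min_le_left _ _) (by linarith))] with ω hω
    refine tendsto_const_nhds.congr' ?_
    filter_upwards [hω] with N hN
    exact (max_eq_right (by linarith)).symm
  rw [tendstoInMeasure_iff_measureReal_norm] at hVlim
  filter_upwards [(hVlim (ε / 2) (half_pos hε)).eventually_lt_const (half_pos hη)] with N hN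
  have hmarkov := mul_meas_ge_le_integral_of_nonneg
    (Eventually.of_forall fun ω => mul_nonneg (mul_nonneg hK hδ.le) (hT0 N ω))
    ((hT N).const_mul (K * δ)) (ε / 2)
  rw [integral_const_mul] at hmarkov
  have h3 : P.real {ω | ε / 2 ≤ K * δ * T N ω} ≤ 2 * (K * δ * C) / ε := by
    rw [le_div_iff₀ hε]
    have := mul_le_mul_of_nonneg_left (hC N) (mul_nonneg hK hδ.le)
    linarith
  have hsub : {ω | ε ≤ ‖R N ω - 0‖} ⊆
      {ω | ε / 2 ≤ ‖V N ω - 0‖} ∪ {ω | ε / 2 ≤ K * δ * T N ω} := by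
    intro ω hω
    simp only [sub_zero, Real.norm_eq_abs, Set.mem_union, Set.mem_ofPred_eq] at hω ⊢
    by_contra! hcon
    have h5 : |R N ω| - K * δ * T N ω ≤ |V N ω| := (le_max_left _ _).trans (le_abs_self _)
    linarith [hcon.1, hcon.2]
  have h4 := (measureReal_mono (μ := P) hsub).trans (measureReal_union_le _ _)
  linarith

variable {E : Type*} [MeasurableSpace E] {X : Ω → E} {Xs : ℕ → Ω → E}

/-- With y = √N·|mean error|, y ≤ 1 + y², and E y² is the variance of one observation for N ≠ 0: a
bound independent of N. -/
lemma fluctuation_bound (hindep : iIndepFun Xs P) (hident : ∀ k, IdentDistrib (Xs k) X P P)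
    {w : E → ℝ} (hw : Measurable w) (hi : MemLp (fun ω => w (X ω)) 2 P) (N : ℕ) :
    Integrable (fun ω => Real.sqrt N *
        |(∑ k ∈ Finset.range N, w (Xs k ω)) / N - ∫ ω, w (X ω) ∂P|) P ∧
      ∫ ω, Real.sqrt N * |(∑ k ∈ Finset.range N, w (Xs k ω)) / N - ∫ ω, w (X ω) ∂P| ∂P
        ≤ 1 + variance (fun ω => w (X ω)) P := by
  have hid : ∀ k, IdentDistrib (fun ω => w (Xs k ω)) (fun ω => w (X ω)) P P :=
    fun k => (hident k).comp hw
  have hL : ∀ k, MemLp (fun ω => w (Xs k ω)) 2 P := fun k => (hid k).memLp_iff.2 hi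
  have hI : ∀ k, Integrable (fun ω => w (Xs k ω)) P := fun k => (hL k).integrable one_le_two
  set m := ∫ ω, w (X ω) ∂P with hm
  have hsum : MemLp (fun ω => ∑ k ∈ Finset.range N, w (Xs k ω)) 2 P :=
    memLp_finsetSum _ fun k _ => hL k
  have hmem : MemLp (fun ω => (∑ k ∈ Finset.range N, w (Xs k ω)) / N - m) 2 P := by
    simp only [div_eq_mul_inv]
    exact (hsum.mul_const _).sub (memLp_const m)
  have hint : Integrable (fun ω => Real.sqrt N *
      |(∑ k ∈ Finset.range N, w (Xs k ω)) / N - m|) P :=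
    (hmem.integrable one_le_two).abs.const_mul _
  refine ⟨hint, ?_⟩
  rcases eq_or_ne N 0 with rfl | hN
  · simp only [Nat.cast_zero, Real.sqrt_zero, zero_mul, integral_zero]
    linarith [variance_nonneg (fun ω => w (X ω)) P]
  have hNr : (N : ℝ) ≠ 0 := by exact_mod_cast hN
  have hvar : variance (fun ω => ∑ k ∈ Finset.range N, w (Xs k ω)) P
      = N * variance (fun ω => w (X ω)) P := by
    have h := IndepFun.variance_sum (s := Finset.range N) (fun k _ => hL k)
      fun i _ j _ hij => (hindep.comp (fun _ => w) fun _ => hw).indepFun hij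
    have hfun : (fun ω => ∑ k ∈ Finset.range N, w (Xs k ω))
        = ∑ k ∈ Finset.range N, fun ω => w (Xs k ω) := by
      ext ω; simp
    rw [hfun, h, Finset.sum_congr rfl fun k _ => (hid k).variance_eq]
    simp
  have hmean : ∫ ω, ∑ k ∈ Finset.range N, w (Xs k ω) ∂P = N * m := by
    rw [integral_finsetSum _ fun k _ => hI k, Finset.sum_congr rfl fun k _ => (hid k).integral_eq]
    simp [hm]
  have hsq : ∫ ω, N * ((∑ k ∈ Finset.range N, w (Xs k ω)) / N - m) ^ 2 ∂P
      = variance (fun ω => w (X ω)) P := by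
    rw [variance_eq_integral hsum.aemeasurable, hmean] at hvar
    have h1 : ∀ ω, N * ((∑ k ∈ Finset.range N, w (Xs k ω)) / N - m) ^ 2
        = (N : ℝ)⁻¹ * (∑ k ∈ Finset.range N, w (Xs k ω) - N * m) ^ 2 := fun ω => by
      field_simp
    simp only [h1]
    rw [integral_const_mul, hvar]
    field_simp
  rw [← hsq]
  have hi2 : Integrable (fun ω => N * ((∑ k ∈ Finset.range N, w (Xs k ω)) / N - m) ^ 2) P :=
    hmem.integrable_sq.const_mul _
  calc _ ≤ ∫ ω, (1 + N * ((∑ k ∈ Finset.range N, w (Xs k ω)) / N - m) ^ 2) ∂P := by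
        refine integral_mono hint ((integrable_const 1).add hi2) fun ω => ?_
        simp only
        set v := (∑ k ∈ Finset.range N, w (Xs k ω)) / N - m
        have h2 : N * v ^ 2 = (Real.sqrt N * |v|) ^ 2 := by
          rw [mul_pow, Real.sq_sqrt (Nat.cast_nonneg N), sq_abs]
        rw [h2]
        nlinarith [sq_nonneg (Real.sqrt N * |v| - 1)]
    _ = _ := by rw [integral_add (integrable_const 1) hi2]; simp

/-- The central limit theorem for the empirical mean of a centered function of the sample. -/
lemma clt_mean (hindep : iIndepFun Xs P) (hident : ∀ k, IdentDistrib (Xs k) X P P)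
    {w : E → ℝ} (hw : Measurable w) (hi : MemLp (fun ω => w (X ω)) 2 P)
    (h0 : ∫ ω, w (X ω) ∂P = 0) :
    TendstoInDistribution (fun (N : ℕ) ω => Real.sqrt N *
        ((∑ k ∈ Finset.range N, w (Xs k ω)) / N)) atTop (fun z : ℝ => z) (fun _ => P)
      (gaussianReal 0 (variance (fun ω => w (X ω)) P).toNNReal) := by
  have hid : ∀ k, IdentDistrib (fun ω => w (Xs k ω)) (fun ω => w (X ω)) P P :=
    fun k => (hident k).comp hw
  have h := tendstoInDistribution_inv_sqrt_mul_sum_sub (P := P)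
    (P' := gaussianReal 0 (variance (fun ω => w (X ω)) P).toNNReal)
    (X := fun k ω => w (Xs k ω)) (Y := fun z : ℝ => z)
    ⟨aemeasurable_id', by rw [Measure.map_id', (hid 0).variance_eq]⟩ ((hid 0).memLp_iff.2 hi)
    (hindep.comp (fun _ => w) fun _ => hw) fun k => (hid k).trans (hid 0).symm
  refine h.congr (fun N => Eventually.of_forall fun ω => ?_) (Eventually.of_forall fun _ => rfl)
  simp only [(hid 0).integral_eq, h0, mul_zero, sub_zero]
  rw [mul_div_left_comm, Real.sqrt_div_self', one_div, mul_comm]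

end Probability

end DQ
namespace DQ

/-! ### Moments of the influence function and the asymptotic variance. -/

section Population

variable {Ω : Type*} [MeasurableSpace Ω] {P : Measure Ω} [IsProbabilityMeasure P]

lemma memLp_two_of_moment {Y : Ω → ℝ} (hY : Measurable Y)
    (h : ∃ ε : ℝ, 0 < ε ∧ Integrable (fun ω => |Y ω| ^ (2 + ε)) P) : MemLp Y 2 P := by
  obtain ⟨ε, hε, hi⟩ := h
  rw [memLp_two_iff_integrable_sq hY.aestronglyMeasurable]
  refine ((integrable_const 1).add hi).mono' (hY.pow_const 2).aestronglyMeasurable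
    (Eventually.of_forall fun ω => ?_)
  have hpos : 0 ≤ |Y ω| ^ (2 + ε) := Real.rpow_nonneg (abs_nonneg _) _
  rw [Real.norm_eq_abs, abs_of_nonneg (sq_nonneg _), ← sq_abs]
  simp only [Pi.add_apply]
  rcases le_total |Y ω| 1 with h1 | h1
  · have := pow_le_one₀ (n := 2) (abs_nonneg (Y ω)) h1
    linarith
  · have := Real.rpow_le_rpow_of_exponent_le h1 (show (2 : ℝ) ≤ 2 + ε by linarith)
    rw [Real.rpow_two] at this
    linarith

lemma memLp_excess {Y : Ω → ℝ} (h : MemLp Y 2 P) (t : ℝ) :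
    MemLp (fun ω => max (Y ω - t) 0) 2 P :=
  (h.sub (memLp_const t)).pos_part

variable {n : ℕ} {X : Ω → Fin n → ℝ}

lemma measurable_influence (α a s : ℝ) (t : Fin n → ℝ) : Measurable (influence α a s t) := by
  unfold influence total; fun_prop

lemma memLp_influence (hi : ∀ i, MemLp (fun ω => X ω i) 2 P) (α a s : ℝ) (t : Fin n → ℝ) :
    MemLp (fun ω => influence α a s t (X ω)) 2 P := by
  have h1 : MemLp (fun ω => max (total X ω - s) 0) 2 P :=
    memLp_excess (memLp_finsetSum _ fun i _ => hi i) s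
  have h2 : MemLp (fun ω => ∑ i, (t i + max (X ω i - t i) 0 / α) - s) 2 P := by
    simp only [div_eq_mul_inv]
    exact (memLp_finsetSum _ fun i _ => (memLp_const (t i)).add
      ((memLp_excess (hi i) (t i)).mul_const α⁻¹)).sub (memLp_const s)
  exact h1.sub (h2.const_mul a)

lemma integral_influence (hi : ∀ i, Integrable (fun ω => X ω i) P) (α a s : ℝ) (t : Fin n → ℝ) :
    ∫ ω, influence α a s t (X ω) ∂P = stopLoss P (total X) s
      - a * (∑ i, (t i + stopLoss P (fun ω => X ω i) (t i) / α) - s) := by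
  have h1 : Integrable (fun ω => max (total X ω - s) 0) P :=
    integrable_excess (integrable_total hi) s
  have h2 : ∀ i, Integrable (fun ω => t i + max (X ω i - t i) 0 / α) P := fun i =>
    (integrable_const (t i)).add ((integrable_excess (hi i) (t i)).div_const α)
  have h3 : Integrable (fun ω => ∑ i, (t i + max (X ω i - t i) 0 / α)) P :=
    integrable_finsetSum _ fun i _ => h2 i
  have h4 : ∀ i, ∫ ω, (t i + max (X ω i - t i) 0 / α) ∂P
      = t i + stopLoss P (fun ω => X ω i) (t i) / α := fun i => by
    rw [integral_add (integrable_const _) ((integrable_excess (hi i) (t i)).div_const α),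
      integral_div]
    simp [stopLoss]
  change ∫ ω, (max (total X ω - s) 0
    - a * (∑ i, (t i + max (X ω i - t i) 0 / α) - s)) ∂P = _
  rw [integral_sub h1 (by exact (h3.sub (integrable_const s)).const_mul a), integral_const_mul,
    integral_sub h3 (integrable_const s), integral_finsetSum _ fun i _ => h2 i]
  simp [h4, stopLoss]

/-- The quadratic form of the covariance matrix of the excesses is a variance. -/
lemma quadraticForm_covMat (hi : ∀ i, MemLp (fun ω => X ω i) 2 P) {α : ℝ}
    (ha : alphaStar P α X ≠ 0) :
    dotProduct (vecA P α X) (Matrix.mulVec (covMat P α X) (vecA P α X))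
      = variance (fun ω => influence α (alphaStar P α X)
          (quantile P (total X) (1 - alphaStar P α X))
          (fun i => quantile P (fun ω' => X ω' i) (1 - α)) (X ω)) P / alphaStar P α X ^ 2 := by
  set a := alphaStar P α X with haDef
  set s := quantile P (total X) (1 - a) with hs
  set t : Fin n → ℝ := fun i => quantile P (fun ω' => X ω' i) (1 - α) with ht
  have hL : ∀ j, MemLp (fun ω => excess P α X ω j) 2 P := by
    intro j
    refine Fin.lastCases ?_ (fun i => ?_) j
    · simp only [excess, Fin.snoc_last]
      exact memLp_excess (memLp_finsetSum _ fun i _ => hi i) _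
    · simp only [excess, Fin.snoc_castSucc]
      exact memLp_excess (hi i) _
  have h1 : dotProduct (vecA P α X) (Matrix.mulVec (covMat P α X) (vecA P α X))
      = variance (fun ω => ∑ j, vecA P α X j * excess P α X ω j) P := by
    rw [variance_fun_sum fun j => (hL j).const_mul _]
    simp only [dotProduct, Matrix.mulVec, covMat, Matrix.of_apply, Finset.mul_sum]
    refine Finset.sum_congr rfl fun i _ => Finset.sum_congr rfl fun j _ => ?_
    rw [covariance_const_mul_left, covariance_const_mul_right]
    ring
  -- The combination A · excess is −1/α* times the influence up to a constant, which the variance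
  -- ignores.
  have h2 : ∀ ω, ∑ j, vecA P α X j * excess P α X ω j
      = (-1 / a) * influence α a s t (X ω) + (s - ∑ i, t i) := by
    intro ω
    rw [Fin.sum_univ_castSucc]
    simp only [vecA, excess, Fin.snoc_castSucc, Fin.snoc_last, influence, ← haDef, ← hs,
      Finset.sum_add_distrib, ← Finset.mul_sum, ← Finset.sum_div]
    have hT : total (fun y : Fin n → ℝ => y) (X ω) = total X ω := rfl
    rw [hT]
    field_simp
    ring
  have hm := memLp_influence hi α a s t
  rw [h1, funext h2, variance_add_const (hm.aestronglyMeasurable.const_mul _),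
    variance_const_mul]
  field_simp

end Population

end DQ

/-! ### The limit theorem. -/

theorem theorem3 {Ω : Type*} [MeasurableSpace Ω] (P : Measure Ω) [IsProbabilityMeasure P]
    (n : ℕ) (α : ℝ) (hα0 : 0 < α) (hα1 : α < 1)
    (X : Ω → Fin n → ℝ) (hX : Measurable X)
    (Xs : ℕ → Ω → Fin n → ℝ) (hXs : ∀ k, Measurable (Xs k))
    (hindep : iIndepFun Xs P) (hident : ∀ k, IdentDistrib (Xs k) X P P)
    (hunique : ((∑ i, DQ.ES P α (fun ω => X ω i) : ℝ) : EReal)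
      < essSup (fun ω => ((DQ.total X ω : ℝ) : EReal)) P)
    (hcomp : ∀ i, DQ.ComponentCondition P α (fun ω => X ω i))
    (htotal : DQ.TotalCondition P (DQ.alphaStar P α X) (DQ.total X)) :
    0 < DQ.DQES P α X ∧ DQ.cES P α X ≠ 0 ∧ 0 ≤ DQ.sigmaSq P α X ∧
    TendstoInDistribution
      (fun (N : ℕ) (ω : Ω) => Real.sqrt N *
        (DQ.empiricalDQES α (fun k => Xs k ω) N - DQ.DQES P α X))
      atTop (fun z : ℝ => z) (fun _ => P)
      (gaussianReal 0 (Real.toNNReal (DQ.sigmaSq P α X))) := by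
  open DQ in
  have hXi : ∀ i, Measurable fun ω => X ω i := measurable_pi_iff.1 hX
  have hL2 : ∀ i, MemLp (fun ω => X ω i) 2 P := fun i => memLp_two_of_moment (hXi i) (hcomp i).2
  have hi : ∀ i, Integrable (fun ω => X ω i) P := fun i => (hL2 i).integrable one_le_two
  have hS := measurable_total hX
  have hSi := integrable_total hi
  have ha0 := alphaStar_pos hX hi hα0 hα1 hunique
  have ha1 := (alphaStar_le_self hX hi hα0 hα1).trans_lt hα1
  have hES := ES_alphaStar hX hi hα0 hα1 ha0
  have hquad := quadraticForm_covMat hL2 ha0.ne'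
  set a := alphaStar P α X with haDef
  have hsV : quantile P (total X) (1 - a) = VaR P a (total X) := rfl
  have htV : ∀ i, quantile P (fun ω' => X ω' i) (1 - α) = VaR P α fun ω => X ω i := fun _ => rfl
  obtain ⟨⟨g, hg, hgpos, -⟩, -⟩ := htotal
  rw [hsV] at hgpos
  simp only [hsV, htV] at hquad
  set s := VaR P a (total X) with hs
  set t : Fin n → ℝ := fun i => VaR P α fun ω => X ω i with ht
  set M := ∑ i, ES P α (fun ω => X ω i) with hM
  have hpS : P.real {ω | s < total X ω} = a :=
    measure_gt_VaR hS ha0 ha1 (hg.measure_singleton (Set.mem_univ _))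
  have hp : ∀ i, P.real {ω | t i < X ω i} = α := fun i => by
    obtain ⟨⟨f, hf, -⟩, -⟩ := hcomp i
    exact measure_gt_VaR (hXi i) hα0 hα1 (hf.measure_singleton Set.self_mem_Ici)
  have hminS : ∀ δ : ℝ, 0 < δ → _ := fun δ hδ =>
    strict_minimizer hS hSi ha0 ha1 hg (Set.subset_univ _) hgpos (δ := δ) hδ
  have hminX : ∀ i, ∀ δ, 0 < δ →
      α * t i + stopLoss P (fun ω => X ω i) (t i)
          < α * (t i + δ) + stopLoss P (fun ω => X ω i) (t i + δ) ∧
        α * t i + stopLoss P (fun ω => X ω i) (t i)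
          < α * (t i - δ) + stopLoss P (fun ω => X ω i) (t i - δ) := fun i δ hδ => by
    obtain ⟨⟨f, hf, hfpos⟩, -⟩ := hcomp i
    exact strict_minimizer (hXi i) (hi i) hα0 hα1 hf subset_rfl hfpos hδ
  have hSL : stopLoss P (total X) s = a * (M - s) := by
    have := mul_ES_eq_VaR hS hSi ha0 ha1
    rw [hES] at this
    linarith
  have hu : 0 < M - s := by
    have h := stopLoss_pos hSi (hpS.symm ▸ ha0)
    rw [hSL] at h
    exact pos_of_mul_pos_right h ha0.le
  set u := M - s with huDef
  have hMu : ∑ i, (t i + stopLoss P (fun ω => X ω i) (t i) / α) - s = u := by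
    rw [huDef, hM]
    congr 1
    refine Finset.sum_congr rfl fun i _ => ?_
    have := mul_ES_eq_VaR (hXi i) (hi i) hα0 hα1
    field_simp
    linarith
  have hDQ : DQES P α X = a / α := rfl
  have hc : cES P α X = -u / (a / α) := by
    rw [cES, hDQ, ← haDef, hES, ← hs, huDef, neg_sub]
  -- The quadratic form is Var(influence)/a² and c = −uα/a, so a cancels.
  have hsigma : sigmaSq P α X
      = variance (fun ω => influence α a s t (X ω) / u / α) P := by
    have : (fun ω => influence α a s t (X ω) / u / α)
        = fun ω => (1 / (u * α)) * influence α a s t (X ω) := by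
      ext ω; field_simp
    rw [sigmaSq, hquad, hc, this, variance_const_mul]
    field_simp
  refine ⟨div_pos ha0 hα0, ?_, ?_, ?_⟩
  · rw [hc]
    exact div_ne_zero (neg_ne_zero.2 hu.ne') (div_pos ha0 hα0).ne'
  · rw [hsigma]
    exact variance_nonneg _ _
  have hmeasI := measurable_influence α a s t
  have hLI := memLp_influence hL2 α a s t
  have hI0 : ∫ ω, influence α a s t (X ω) ∂P = 0 := by
    rw [integral_influence hi, hMu, hSL, sub_self]
  have hclt := clt_mean hindep hident (w := fun y => influence α a s t y / u / α)
    (by fun_prop) (by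
      simp only [div_eq_mul_inv]
      exact (hLI.mul_const _).mul_const _) (by
      rw [integral_div, integral_div, hI0]; simp)
  rw [← hsigma] at hclt
  have hYm : ∀ N : ℕ, Measurable fun ω => Real.sqrt N *
      (empiricalDQES α (fun k => Xs k ω) N - DQES P α X) := fun N =>
    ((measurable_empiricalDQES hXs hα0 hα1 N).sub_const _).const_mul _
  -- Slutsky: only the difference from the linearized sequence remains to be treated.
  refine tendstoInDistribution_of_tendstoInMeasure_sub _ _ hclt ?_ fun N => (hYm N).aemeasurable
  have hSm : Measurable (total fun y : Fin n → ℝ => y) := measurable_total measurable_id'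
  have hindS : Measurable ({y : Fin n → ℝ | s < total (fun y => y) y}.indicator
      fun _ => (1 : ℝ)) := measurable_const.indicator (measurableSet_lt measurable_const hSm)
  have hindX : ∀ i, Measurable ({y : Fin n → ℝ | t i < y i}.indicator fun _ => (1 : ℝ)) :=
    fun i => measurable_const.indicator
      (measurableSet_lt measurable_const (measurable_pi_apply i))
  have hindS_int : ∫ ω, {y : Fin n → ℝ | s < total (fun y => y) y}.indicator
      (fun _ => (1 : ℝ)) (X ω) ∂P = a := hpS ▸ integral_indicator_gt hS s
  have hindX_int : ∀ i, ∫ ω, {y : Fin n → ℝ | t i < y i}.indicator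
      (fun _ => (1 : ℝ)) (X ω) ∂P = α := fun i => (integral_indicator_gt (hXi i) (t i)).trans (hp i)
  have hindS_mem : MemLp (fun ω => {y : Fin n → ℝ | s < total (fun y => y) y}.indicator
      (fun _ => (1 : ℝ)) (X ω)) 2 P :=
    memLp_indicator_const 2 (measurableSet_lt measurable_const hS) 1 (Or.inr (measure_ne_top _ _))
  have hindX_mem : ∀ i, MemLp (fun ω => {y : Fin n → ℝ | t i < y i}.indicator
      (fun _ => (1 : ℝ)) (X ω)) 2 P := fun i =>
    memLp_indicator_const 2 (measurableSet_lt measurable_const (hXi i)) 1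
      (Or.inr (measure_ne_top _ _))
  have henv : ∀ N : ℕ, (fun ω => envelope α a s t (fun k => Xs k ω) N) = fun ω =>
      1 + (Real.sqrt N * |(∑ k ∈ Finset.range N, influence α a s t (Xs k ω)) / N
        - ∫ ω, influence α a s t (X ω) ∂P|
      + Real.sqrt N * |(∑ k ∈ Finset.range N, {y : Fin n → ℝ | s < total (fun y => y) y}.indicator
        (fun _ => (1 : ℝ)) (Xs k ω)) / N - ∫ ω, {y : Fin n → ℝ |
          s < total (fun y => y) y}.indicator (fun _ => (1 : ℝ)) (X ω) ∂P|
      + ∑ i, Real.sqrt N * |(∑ k ∈ Finset.range N, {y : Fin n → ℝ | t i < y i}.indicator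
        (fun _ => (1 : ℝ)) (Xs k ω)) / N - ∫ ω, {y : Fin n → ℝ | t i < y i}.indicator
          (fun _ => (1 : ℝ)) (X ω) ∂P|) := fun N => by
    ext ω
    rw [hI0, hindS_int]
    simp only [hindX_int, envelope, measure_gt_empirical _ _ hSm,
      measure_gt_empirical _ _ (measurable_pi_apply _), ← Finset.mul_sum, sub_zero]
    ring
  have b1 := fluctuation_bound hindep hident hmeasI hLI
  have b2 := fluctuation_bound hindep hident hindS hindS_mem
  have b3 := fun i => fluctuation_bound hindep hident (hindX i) (hindX_mem i)
  have b3' := fun N => integrable_finsetSum (μ := P) Finset.univ fun i _ => (b3 i N).1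
  have hTint : ∀ N, Integrable (fun ω => envelope α a s t (fun k => Xs k ω) N) P := fun N => by
    rw [henv N]
    exact (integrable_const 1).add (((b1 N).1.add (b2 N).1).add (b3' N))
  obtain ⟨C, hTle⟩ : ∃ C, ∀ N, ∫ ω, envelope α a s t (fun k => Xs k ω) N ∂P ≤ C := by
    refine ⟨1 + ((1 + variance (fun ω => influence α a s t (X ω)) P)
      + (1 + variance (fun ω => {y : Fin n → ℝ | s < total (fun y => y) y}.indicator
        (fun _ => (1 : ℝ)) (X ω)) P)
      + ∑ i, (1 + variance (fun ω => {y : Fin n → ℝ | t i < y i}.indicator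
        (fun _ => (1 : ℝ)) (X ω)) P)), fun N => ?_⟩
    rw [henv N, integral_add (integrable_const 1)
      (by exact ((b1 N).1.add (b2 N).1).add (b3' N)),
      integral_add (by exact (b1 N).1.add (b2 N).1) (b3' N), integral_add (b1 N).1 (b2 N).1,
      integral_finsetSum _ fun i _ => (b3 i N).1]
    exact add_le_add (by simp) (add_le_add (add_le_add (b1 N).2 (b2 N).2)
      (Finset.sum_le_sum fun i _ => (b3 i N).2))
  -- `K` is the constant of `eventually_remainder` divided by α, as DQ = α*/α; `δ₀` encodes δ ≤ 1
  -- and 4δ < u. The null set may depend on δ, so almost sure convergence at finitely many points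
  -- suffices for each δ.
  refine tendstoInMeasure_zero_of_eventually_le
    (T := fun N ω => envelope α a s t (fun k => Xs k ω) N)
    (K := (4 / u * (2 / u * (1 + a / α) + 1) + 2 + 2 / u * (a / α)) / α)
    (δ₀ := min 1 (u / 4)) (fun N => ?_) hTint (fun N ω => ?_) hTle (by positivity)
    (lt_min one_pos (by positivity)) fun δ hδ hδ0 => ?_
  · exact ((hYm N).sub ((Finset.measurable_sum _ fun k _ =>
      ((hmeasI.comp (hXs k)).div_const u).div_const α).div_const _
        |>.const_mul _)).aestronglyMeasurable
  · unfold envelope; positivity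
  have hslX : ∀ y, ∀ᵐ ω ∂P, ∀ i, Tendsto (fun N => stopLoss (empiricalMeasure
      (fun k => Xs k ω) N) (fun y => y i) (t i + y)) atTop
        (nhds (stopLoss P (fun ω => X ω i) (t i + y))) := fun y => by
    refine ae_all_iff.2 fun i => ?_
    simp only [stopLoss_empirical]
    exact ae_tendsto_mean hindep hident (w := fun z => max (z i - (t i + y)) 0) (by fun_prop)
      (integrable_excess (hi i) _)
  have hslS : ∀ y, ∀ᵐ ω ∂P, Tendsto (fun N => stopLoss (empiricalMeasure
      (fun k => Xs k ω) N) (total fun y : Fin n → ℝ => y) y) atTop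
        (nhds (stopLoss P (total X) y)) := fun y => by
    simp only [stopLoss_empirical]
    exact ae_tendsto_mean hindep hident
      (w := fun z => max (total (fun y : Fin n → ℝ => y) z - y) 0) (by fun_prop)
      (integrable_excess hSi _)
  have hprS := ae_tendsto_mean hindep hident hindS (hindS_mem.integrable one_le_two)
  have hprX := ae_all_iff.2 fun i =>
    ae_tendsto_mean hindep hident (hindX i) ((hindX_mem i).integrable one_le_two)
  filter_upwards [hslX 0, hslX δ, hslX (-δ), hslS s, hslS (s + δ), hslS (s - δ), hprS, hprX]
    with ω h1 h2 h3 h4 h5 h6 h7 h8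
  have hev := eventually_remainder (x := fun k => Xs k ω) (t := t) (s := s) (a := a) (α := α)
    (u := u) (δ := δ) (L := fun i => stopLoss P fun ω => X ω i) (LS := stopLoss P (total X))
    hα0 hα1 ha0 ha1 hu hδ (hδ0.le.trans (min_le_left _ _))
    (by linarith [hδ0.trans_le (min_le_right 1 (u / 4))])
    (by simpa using h1) h2 (by simpa only [sub_eq_add_neg] using h3)
    (fun i => by
      simp only [measure_gt_empirical _ _ (measurable_pi_apply i)]
      simpa only [hindX_int] using h8 i)
    h4 h5 h6
    (by
      simp only [measure_gt_empirical _ _ hSm]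
      simpa only [hindS_int] using h7)
    (fun i => (hminX i δ hδ).1) (fun i => (hminX i δ hδ).2) (hminS δ hδ).1 (hminS δ hδ).2 hMu hSL
  filter_upwards [hev] with N hN
  have hdecomp : Real.sqrt N * (empiricalDQES α (fun k => Xs k ω) N - DQES P α X)
      - Real.sqrt N * ((∑ k ∈ Finset.range N, influence α a s t (Xs k ω) / u / α) / N)
      = (Real.sqrt N * (alphaStar (empiricalMeasure (fun k => Xs k ω) N) α
        (fun y : Fin n → ℝ => y) - a) - Real.sqrt N *
        ((∑ k ∈ Finset.range N, influence α a s t (Xs k ω)) / N / u)) / α := by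
    rw [← Finset.sum_div, ← Finset.sum_div, hDQ, empiricalDQES, DQES]
    ring
  simp only [Pi.sub_apply]
  rw [hdecomp, abs_div, abs_of_pos hα0, div_mul_eq_mul_div, div_mul_eq_mul_div]
  gcongr
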